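/- Let $(A_0,A_1)$ be a compatible couple of quasi-normed spaces, i.e. $A_0,A_1$ are continuously embedded in one Hausdorff topological vector space. For $f\in A_0+A_1$ and $t>0$ put $K(t,f;A_0,A_1)=\inf\{\|f_0\|_{A_0}+t\|f_1\|_{A_1}: f=f_0+f_1,\ f_j\in A_j\}$. For non-negative quantities, $F\approx G$ means $cG\le F\le CG$ with constants $0<c\le C<\infty$ independent of the variable. A Lebesgue measurable $b:(0,\infty)\to(0,\infty)$ is slowly varying ($b\in SV$) if for every $\varepsilon>0$ there are a positive non-decreasing function $g$ and a positive non-increasing function $h$ on $(0,\infty)$ with $t^{\varepsilon}b(t)\approx g(t)$ and $t^{-\varepsilon}b(t)\approx h(t)$, $t>0$. For $0<q<\infty$, $b\in SV_{0,q}$ means that $b\in SV$ and $\int_1^\infty b^q(u)\frac{du}{u}<\infty$. For $0\le\theta\le 1$, $0<q<\infty$ and a positive function $b$ on $(0,\infty)$, the space $\bar A_{\theta,q;b}=(A_0,A_1)_{\theta,q;b}$ consists of all $f\in A_0+A_1$ with $$\|f\|_{\bar A_{\theta,q;b}}=\left(\int_0^\infty\left[t^{-\theta}b(t)K(t,f;A_0,A_1)\right]^q\frac{dt}{t}\right)^{1/q}<\infty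 .$$ The couple is $K$-surjective if for every quasi-concave $\phi:(0,\infty)\to(0,\infty)$ (i.e. $\phi(t)$ and $t\phi(1/t)$ are non-decreasing) there is $f\in A_0+A_1$ with $\phi(t)\approx K(t,f;A_0,A_1)$, $t>0$. **Theorem.** Let $0<q_0,q_1,q<\infty$, $0<\theta<1$, $b_j\in SV_{0,q_j}$ $(j=0,1)$ and $b\in SV$. For $t>0$ and $\epsilon>0$ put $$\rho(t)=\frac{\left(\int_t^\infty b_0^{q_0}(u)\frac{du}{u}\right)^{1/q_0}}{\left(\int_t^\infty b_1^{q_1}(u)\frac{du}{u}\right)^{1/q_1}},\qquad \rho_\epsilon(t)=\frac{\left(\int_t^\infty b_0^{q_0}(u)\frac{du}{u}\right)^{(1+\epsilon)/q_0}}{\left(\int_t^\infty b_1^{q_1}(u)\frac{du}{u}\right)^{1/q_1}} .$$ Assume that $\rho$ is non-decreasing on $(0,\infty)$ with $\lim_{t\to0^+}\rho(t)=0$ and $\lim_{t\to\infty}\rho(t)=\infty$. If $q_0\ne q_1$, assume in addition that for some $\epsilon>0$ the function $\rho_\epsilon$ is equivalent ($\approx$) on $(0,\infty)$ to a non-decreasing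 function. If $q_0=q_1$, assume in addition that $(A_0,A_1)$ is $K$-surjective and that $$\frac{\rho'(t)}{\rho(t)}\approx\frac{t^{-1}b_1^{q_1}(t)}{\int_t^\infty b_1^{q_1}(u)\frac{du}{u}}\qquad\text{for almost every } t>0 .$$ Put $$\tilde b(t)=[\rho(t)]^{1-\theta}\,b(\rho(t))\,[b_1(t)]^{q_1/q}\left(\int_t^\infty b_1^{q_1}(u)\frac{du}{u}\right)^{1/q_1-1/q},\quad t>0 .$$ Then $$\left(\bar A_{0,q_0;b_0},\bar A_{0,q_1;b_1}\right)_{\theta,q;b}=\bar A_{0,q;\tilde b},$$ that is, the two spaces consist of the same elements and their quasi-norms are equivalent, with constants independent of the element. -/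

import Mathlib

open Set Filter Topology MeasureTheory
open scoped ENNReal NNReal

namespace LimitingReiteration

noncomputable section

/-- A function `b` on `(0,∞)` is slowly varying: it is positive, Lebesgue measurable and, for every
`ε > 0`, `t ^ ε * b t` is equivalent to a positive non-decreasing function and `t ^ (-ε) * b t` is
equivalent to a positive non-increasing function on `(0,∞)`. -/
structure IsSlowlyVarying (b : ℝ → ℝ) : Prop where
  pos : ∀ t, 0 < t → 0 < b t
  aemeasurable : AEMeasurable b (volume.restrict (Ioi 0))
  equiv_monotone : ∀ ε : ℝ, 0 < ε → ∃ g : ℝ → ℝ, (∀ t, 0 < t → 0 < g t) ∧ MonotoneOn g (Ioi 0) ∧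
    ∃ c C : ℝ, 0 < c ∧ 0 < C ∧ ∀ t, 0 < t → c * g t ≤ t ^ ε * b t ∧ t ^ ε * b t ≤ C * g t
  equiv_antitone : ∀ ε : ℝ, 0 < ε → ∃ g : ℝ → ℝ, (∀ t, 0 < t → 0 < g t) ∧ AntitoneOn g (Ioi 0) ∧
    ∃ c C : ℝ, 0 < c ∧ 0 < C ∧ ∀ t, 0 < t → c * g t ≤ t ^ (-ε) * b t ∧ t ^ (-ε) * b t ≤ C * g t

/-- The class `SV_{0,q}`, `0 < q < ∞`: slowly varying `b` with `∫_1^∞ b(u)^q du/u < ∞`, that is,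
`u ^ (-1/q) * b u` belongs to `L^q(1,∞)`. -/
structure IsSV0 (q : ℝ) (b : ℝ → ℝ) : Prop where
  slowlyVarying : IsSlowlyVarying b
  integrable_tail : IntegrableOn (fun u => b u ^ q / u) (Ioi 1)

/-- The tail integral `∫_t^∞ b(u)^q du/u`. -/
def tail (q : ℝ) (b : ℝ → ℝ) (t : ℝ) : ℝ := ∫ u in Ioi t, b u ^ q / u

/-- The `L^q(t,∞)` quasi-norm of `u ^ (-1/q) * b u`, `0 < q < ∞`. -/
def tailNorm (q : ℝ) (b : ℝ → ℝ) (t : ℝ) : ℝ := tail q b t ^ (1 / q)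

/-- `ρ(t) = ‖u^{-1/q₀} b₀(u)‖_{q₀,(t,∞)} / ‖u^{-1/q₁} b₁(u)‖_{q₁,(t,∞)}`. -/
def rho (q₀ q₁ : ℝ) (b₀ b₁ : ℝ → ℝ) (t : ℝ) : ℝ := tailNorm q₀ b₀ t / tailNorm q₁ b₁ t

/-- `ρ_ε(t) = ‖u^{-1/q₀} b₀(u)‖_{q₀,(t,∞)}^{1+ε} / ‖u^{-1/q₁} b₁(u)‖_{q₁,(t,∞)}`. -/
def rhoEps (ε q₀ q₁ : ℝ) (b₀ b₁ : ℝ → ℝ) (t : ℝ) : ℝ :=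
  tailNorm q₀ b₀ t ^ (1 + ε) / tailNorm q₁ b₁ t

/-- `F` is equivalent on `(0,∞)` to a non-decreasing function. -/
def EquivNondecreasing (F : ℝ → ℝ) : Prop :=
  ∃ g : ℝ → ℝ, MonotoneOn g (Ioi 0) ∧
    ∃ c C : ℝ, 0 < c ∧ 0 < C ∧ ∀ t, 0 < t → c * g t ≤ F t ∧ F t ≤ C * g t

/-- The weight
`b̃(t) = ρ(t)^{1-θ} b(ρ(t)) b₁(t)^{q₁/q} (∫_t^∞ b₁(u)^{q₁} du/u)^{1/q₁ - 1/q}`. -/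
def btilde (θ q q₀ q₁ : ℝ) (b b₀ b₁ : ℝ → ℝ) (t : ℝ) : ℝ :=
  rho q₀ q₁ b₀ b₁ t ^ (1 - θ) * b (rho q₀ q₁ b₀ b₁ t) * b₁ t ^ (q₁ / q) *
    tail q₁ b₁ t ^ (1 / q₁ - 1 / q)

section Couples

variable {V : Type*} [AddCommGroup V]

/-- A quasi-normed space `A` continuously embedded in a topological vector space `V` is encoded by
its quasi-norm, extended to `V` by the value `∞` outside `A`; so `A = {x | N x < ∞}`, which is a
linear subspace of `V` by `smul` and `add_le`, and `N` is a quasi-norm on it. -/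
structure IsEmbeddedQuasiNorm (𝕜 : Type*) [RCLike 𝕜] [Module 𝕜 V] [TopologicalSpace V]
    (N : V → ℝ≥0∞) : Prop where
  smul : ∀ (c : 𝕜) (x : V), N (c • x) = ‖c‖ₑ * N x
  add_le : ∃ C : ℝ≥0, ∀ x y : V, N (x + y) ≤ C * (N x + N y)
  eq_zero : ∀ x : V, N x = 0 → x = 0
  continuous_embedding : ∀ U ∈ 𝓝 (0 : V), ∃ δ : ℝ≥0∞, 0 < δ ∧ ∀ x : V, N x < δ → x ∈ U

/-- The sum `A₀ + A₁` of the spaces `A_j = {x | N_j x < ∞}`. -/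
def sumSpace (N₀ N₁ : V → ℝ≥0∞) : Set V :=
  {f | ∃ f₀ f₁ : V, N₀ f₀ < ∞ ∧ N₁ f₁ < ∞ ∧ f₀ + f₁ = f}

/-- Peetre's `K`-functional `K(t,f;A₀,A₁)`, `t > 0`, of the couple `A_j = {x | N_j x < ∞}`.
Decompositions with `f₀ ∉ A₀` or `f₁ ∉ A₁` contribute the value `∞`, so that they play no role if
`f ∈ A₀ + A₁`, and `K(t,f;A₀,A₁) = ∞` if `f ∉ A₀ + A₁`. -/
def KFun (N₀ N₁ : V → ℝ≥0∞) (t : ℝ) (f : V) : ℝ≥0∞ :=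
  ⨅ (f₀ : V) (f₁ : V) (_ : f₀ + f₁ = f), N₀ f₀ + ENNReal.ofReal t * N₁ f₁

/-- The quasi-norm of `(A₀, A₁)_{θ,q;b}`, `0 < q < ∞`: the `L^q(0,∞)` quasi-norm of
`t ^ (-θ - 1/q) * b t * K(t,f;A₀,A₁)`, with value `∞` where it is not finite. -/
def interpNorm (N₀ N₁ : V → ℝ≥0∞) (θ q : ℝ) (b : ℝ → ℝ) (f : V) : ℝ≥0∞ :=
  (∫⁻ t in Ioi (0 : ℝ),
    (ENNReal.ofReal (t ^ (-θ - 1 / q) * b t) * KFun N₀ N₁ t f) ^ q) ^ (1 / q)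

/-- The `K`-interpolation space `(A₀, A₁)_{θ,q;b}`. -/
def interpSpace (N₀ N₁ : V → ℝ≥0∞) (θ q : ℝ) (b : ℝ → ℝ) : Set V :=
  {f | f ∈ sumSpace N₀ N₁ ∧ interpNorm N₀ N₁ θ q b f < ∞}

/-- A positive function `φ` on `(0,∞)` is quasi-concave if `φ` and `t ↦ t * φ (1/t)` are
non-decreasing. -/
structure IsQuasiConcave (φ : ℝ → ℝ) : Prop where
  pos : ∀ t, 0 < t → 0 < φ t
  monotone : MonotoneOn φ (Ioi 0)
  monotone_dual : MonotoneOn (fun t => t * φ (1 / t)) (Ioi 0)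

/-- The couple is `K`-surjective: every quasi-concave function is equivalent on `(0,∞)` to
`K(·,f;A₀,A₁)` for some `f ∈ A₀ + A₁`. -/
def KSurjective (N₀ N₁ : V → ℝ≥0∞) : Prop :=
  ∀ φ : ℝ → ℝ, IsQuasiConcave φ → ∃ f ∈ sumSpace N₀ N₁, ∃ c C : ℝ, 0 < c ∧ 0 < C ∧
    ∀ t, 0 < t → ENNReal.ofReal (c * φ t) ≤ KFun N₀ N₁ t f ∧
      KFun N₀ N₁ t f ≤ ENNReal.ofReal (C * φ t)

end Couples

end

end LimitingReiteration

/-! Write `N_j` for the tail norms of `b_j`, so that `ρ = N₀ / N₁`, and `K̄` for the K-functional of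
the couple of limiting spaces. The quasi-norms on both sides of the theorem are reduced to the same
weighted `ℓ^q` sum along one partition of `(0,∞)`.

The points `t_k` are chosen with `N₁(t_k) = Λ^(-k)`. Since `N₀` is non-increasing, `ρ(t_{k+1}) ≤ Λ
ρ(t_k)`; since `ρ_ε` is almost non-decreasing, a large `Λ` forces `2 ρ(t_k) ≤ ρ(t_{k+1})`
(`exists_isGeometricPartition`). For equal exponents the lower bound on `ρ'/ρ` provides such an `ε`
(`exists_rhoEps_le_of_deriv`). With `W_k = ρ(t_k)^(-θ) b(ρ(t_k))`, the norm with weight `b̃` is then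
equivalent to the `ℓ^q` norm of `W_k N₀(t_k) K(t_k,f)`, and the reiterated norm to that of `W_k
K̄(ρ(t_k),f)` (`exists_btilde_bounds`, `exists_weight_bounds`).

It remains to compare `K̄(ρ(t_k),f)` with `N₀(t_k) K(t_k,f)`. The lower estimate is pointwise
(`exists_tailNorm_mul_KFun_le`). For the upper one, a nearly optimal decomposition of `f` at `t_k`
in the original couple gives a Holmstedt-type bound: an `ℓ^{q₀}` sum over the points up to `t_k`,
plus `ρ(t_k)` times an `ℓ^{q₁}` sum over the points from `t_k` on (`exists_KFun_rho_le`). As `0 < θ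
< 1`, `W_k` decays and `ρ(t_k) W_k` grows geometrically up to constants, so a discrete Hardy
inequality (`exists_tsum_weighted_le`) absorbs both sums for all positive `q₀, q₁, q`. -/

namespace LimitingReiteration

/-! ### The K-functional of a quasi-normed couple. -/

section KFunctional

variable {V : Type*} [AddCommGroup V] {N₀ N₁ : V → ℝ≥0∞}

theorem KFun_le {f f₀ f₁ : V} (h : f₀ + f₁ = f) (t : ℝ) :
    KFun N₀ N₁ t f ≤ N₀ f₀ + ENNReal.ofReal t * N₁ f₁ :=
  iInf_le_of_le f₀ (iInf_le_of_le f₁ (iInf_le_of_le h le_rfl))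

theorem le_KFun {f : V} {t : ℝ} {a : ℝ≥0∞}
    (h : ∀ f₀ f₁ : V, f₀ + f₁ = f → a ≤ N₀ f₀ + ENNReal.ofReal t * N₁ f₁) :
    a ≤ KFun N₀ N₁ t f :=
  le_iInf fun f₀ => le_iInf fun f₁ => le_iInf fun hf => h f₀ f₁ hf

theorem KFun_mono (f : V) : Monotone fun t => KFun N₀ N₁ t f := fun s t hst =>
  le_KFun fun f₀ f₁ hf => (KFun_le hf s).trans (by gcongr)

/-- Scaling the cost of a decomposition by `s / t ≤ 1` turns the parameter `t` into `s` and only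
shrinks the first term. -/
theorem ofReal_div_mul_KFun_le (f : V) {s t : ℝ} (hs : 0 < s) (hst : s ≤ t) :
    ENNReal.ofReal (s / t) * KFun N₀ N₁ t f ≤ KFun N₀ N₁ s f := by
  have ht : 0 < t := hs.trans_le hst
  refine le_KFun fun f₀ f₁ hf => ?_
  calc ENNReal.ofReal (s / t) * KFun N₀ N₁ t f
      ≤ ENNReal.ofReal (s / t) * (N₀ f₀ + ENNReal.ofReal t * N₁ f₁) := by
        gcongr
        exact KFun_le hf t
    _ = ENNReal.ofReal (s / t) * N₀ f₀ + ENNReal.ofReal s * N₁ f₁ := by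
        rw [mul_add, ← mul_assoc, ← ENNReal.ofReal_mul (by positivity), div_mul_cancel₀ _ ht.ne']
    _ ≤ 1 * N₀ f₀ + ENNReal.ofReal s * N₁ f₁ := by
        gcongr
        exact ENNReal.ofReal_le_one.2 ((div_le_one ht).2 hst)
    _ = _ := by rw [one_mul]

theorem exists_decomposition_of_KFun_lt {f : V} {t : ℝ} {a : ℝ≥0∞} (h : KFun N₀ N₁ t f < a) :
    ∃ f₀ f₁ : V, f₀ + f₁ = f ∧ N₀ f₀ + ENNReal.ofReal t * N₁ f₁ < a := by
  by_contra! hcon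
  exact absurd (le_KFun hcon) (not_le.2 h)

theorem mem_sumSpace_of_KFun_lt_top {f : V} {t : ℝ} (ht : 0 < t) (h : KFun N₀ N₁ t f < ∞) :
    f ∈ sumSpace N₀ N₁ := by
  obtain ⟨f₀, f₁, hf, hlt⟩ := exists_decomposition_of_KFun_lt h
  obtain ⟨h₀, h₁⟩ := ENNReal.add_lt_top.1 hlt
  refine ⟨f₀, f₁, h₀, ?_, hf⟩
  rcases ENNReal.mul_lt_top_iff.1 h₁ with h | h | h
  · exact h.2
  · exact absurd h (ENNReal.ofReal_pos.2 ht).ne'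
  · exact h ▸ ENNReal.zero_lt_top

variable {𝕜 : Type*} [RCLike 𝕜] [Module 𝕜 V] [TopologicalSpace V]

theorem IsEmbeddedQuasiNorm.map_zero {N : V → ℝ≥0∞} (h : IsEmbeddedQuasiNorm 𝕜 N) : N 0 = 0 := by
  simpa using h.smul 0 0

theorem IsEmbeddedQuasiNorm.map_neg {N : V → ℝ≥0∞} (h : IsEmbeddedQuasiNorm 𝕜 N) (x : V) :
    N (-x) = N x := by
  simpa using h.smul (-1) x

theorem KFun_neg (h₀ : IsEmbeddedQuasiNorm 𝕜 N₀) (h₁ : IsEmbeddedQuasiNorm 𝕜 N₁) (t : ℝ) (f : V) :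
    KFun N₀ N₁ t (-f) = KFun N₀ N₁ t f := by
  have key : ∀ g : V, KFun N₀ N₁ t (-g) ≤ KFun N₀ N₁ t g := fun g =>
    le_KFun fun f₀ f₁ hf => by
      have := KFun_le (N₀ := N₀) (N₁ := N₁) (f := -g) (f₀ := -f₀) (f₁ := -f₁)
        (by rw [← hf]; abel) t
      rwa [h₀.map_neg, h₁.map_neg] at this
  refine le_antisymm (key f) ?_
  simpa using key (-f)

theorem KFun_le_left (h₁ : IsEmbeddedQuasiNorm 𝕜 N₁) (t : ℝ) (f : V) :
    KFun N₀ N₁ t f ≤ N₀ f := by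
  simpa [h₁.map_zero] using KFun_le (N₀ := N₀) (N₁ := N₁) (add_zero f) t

theorem KFun_le_right (h₀ : IsEmbeddedQuasiNorm 𝕜 N₀) (t : ℝ) (f : V) :
    KFun N₀ N₁ t f ≤ ENNReal.ofReal t * N₁ f := by
  simpa [h₀.map_zero] using KFun_le (N₀ := N₀) (N₁ := N₁) (zero_add f) t

theorem exists_KFun_add_le (h₀ : IsEmbeddedQuasiNorm 𝕜 N₀) (h₁ : IsEmbeddedQuasiNorm 𝕜 N₁) :
    ∃ C : ℝ≥0, 1 ≤ C ∧ ∀ (t : ℝ) (f g : V),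
      KFun N₀ N₁ t (f + g) ≤ C * (KFun N₀ N₁ t f + KFun N₀ N₁ t g) := by
  obtain ⟨C₀, hC₀⟩ := h₀.add_le
  obtain ⟨C₁, hC₁⟩ := h₁.add_le
  set C : ℝ≥0 := max 1 (max C₀ C₁) with hC
  have hC0 : (C₀ : ℝ≥0∞) ≤ C := by exact_mod_cast (le_max_left C₀ C₁).trans (le_max_right _ _)
  have hC1 : (C₁ : ℝ≥0∞) ≤ C := by exact_mod_cast (le_max_right C₀ C₁).trans (le_max_right _ _)
  have hCpos : (C : ℝ≥0∞) ≠ 0 := by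
    have : (0 : ℝ≥0) < C := zero_lt_one.trans_le (le_max_left _ _)
    exact_mod_cast this.ne'
  refine ⟨C, le_max_left _ _, fun t f g => ?_⟩
  have key : ∀ f₀ f₁ : V, f₀ + f₁ = f → ∀ g₀ g₁ : V, g₀ + g₁ = g →
      (C : ℝ≥0∞)⁻¹ * KFun N₀ N₁ t (f + g) ≤
        (N₀ f₀ + ENNReal.ofReal t * N₁ f₁) + (N₀ g₀ + ENNReal.ofReal t * N₁ g₁) := by
    intro f₀ f₁ hf g₀ g₁ hg
    rw [mul_comm, ← div_eq_mul_inv]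
    refine ENNReal.div_le_of_le_mul' ?_
    calc KFun N₀ N₁ t (f + g) ≤ N₀ (f₀ + g₀) + ENNReal.ofReal t * N₁ (f₁ + g₁) :=
          KFun_le (by rw [← hf, ← hg]; abel) t
      _ ≤ C * (N₀ f₀ + N₀ g₀) + ENNReal.ofReal t * (C * (N₁ f₁ + N₁ g₁)) := by
          gcongr
          · exact (hC₀ _ _).trans (by gcongr)
          · exact (hC₁ _ _).trans (by gcongr)
      _ = _ := by ring
  have h2 : (C : ℝ≥0∞)⁻¹ * KFun N₀ N₁ t (f + g) ≤ KFun N₀ N₁ t f + KFun N₀ N₁ t g := by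
    -- The two infima on the right are taken one at a time: truncated subtraction moves the other
    -- summand across.
    rw [← tsub_le_iff_right]
    refine le_KFun fun f₀ f₁ hf => ?_
    rw [tsub_le_iff_right, ← tsub_le_iff_left]
    refine le_KFun fun g₀ g₁ hg => ?_
    rw [tsub_le_iff_left]
    exact key f₀ f₁ hf g₀ g₁ hg
  rw [mul_comm, ← div_eq_mul_inv] at h2
  exact (ENNReal.div_le_iff' hCpos ENNReal.coe_ne_top).1 h2

/-- A vanishing K-functional provides decompositions with both pieces arbitrarily small in the
ambient space, while the Hausdorff property separates a nonzero `f` from `0`. -/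
theorem eq_zero_of_KFun_eq_zero [IsTopologicalAddGroup V] [T2Space V]
    (h₀ : IsEmbeddedQuasiNorm 𝕜 N₀) (h₁ : IsEmbeddedQuasiNorm 𝕜 N₁) {t : ℝ} (ht : 0 < t) {f : V}
    (hf : KFun N₀ N₁ t f = 0) : f = 0 := by
  by_contra hne
  have hU : {f}ᶜ ∈ 𝓝 (0 : V) := isOpen_compl_singleton.mem_nhds (fun h => hne (by simpa using h.symm))
  have hadd : Tendsto (fun p : V × V => p.1 + p.2) (𝓝 0 ×ˢ 𝓝 0) (𝓝 0) := by
    simpa [nhds_prod_eq] using (continuous_add (M := V)).tendsto (0, 0)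
  obtain ⟨U₀, hU₀, U₁, hU₁, hsub⟩ := Filter.mem_prod_iff.1 (hadd hU)
  obtain ⟨δ₀, hδ₀, hN₀⟩ := h₀.continuous_embedding U₀ hU₀
  obtain ⟨δ₁, hδ₁, hN₁⟩ := h₁.continuous_embedding U₁ hU₁
  have ht' : 0 < ENNReal.ofReal t := ENNReal.ofReal_pos.2 ht
  have hpos : KFun N₀ N₁ t f < min δ₀ (ENNReal.ofReal t * δ₁) := by
    rw [hf]
    exact lt_min hδ₀ (ENNReal.mul_pos ht'.ne' hδ₁.ne')
  obtain ⟨f₀, f₁, hsum, hlt⟩ := exists_decomposition_of_KFun_lt hpos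
  have hf₀ : f₀ ∈ U₀ := hN₀ f₀ ((le_self_add.trans_lt hlt).trans_le (min_le_left _ _))
  have hf₁ : f₁ ∈ U₁ := hN₁ f₁ (by
    have : ENNReal.ofReal t * N₁ f₁ < ENNReal.ofReal t * δ₁ :=
      (le_add_self.trans_lt hlt).trans_le (min_le_right _ _)
    exact lt_of_mul_lt_mul_left' this)
  have : f₀ + f₁ ∈ ({f}ᶜ : Set V) := hsub (show (f₀, f₁) ∈ U₀ ×ˢ U₁ from ⟨hf₀, hf₁⟩)
  exact this (by simpa using hsum)

/-- A nearly optimal decomposition at `t` splits the `K`-functional at `t`. -/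
theorem exists_decomposition_KFun_le [IsTopologicalAddGroup V] [T2Space V]
    (h₀ : IsEmbeddedQuasiNorm 𝕜 N₀) (h₁ : IsEmbeddedQuasiNorm 𝕜 N₁) :
    ∃ C : ℝ≥0, ∀ t : ℝ, 0 < t → ∀ f : V, KFun N₀ N₁ t f < ∞ → ∃ f₀ f₁ : V, f₀ + f₁ = f ∧
      (∀ s, 0 < s → s ≤ t → KFun N₀ N₁ s f₀ ≤ C * KFun N₀ N₁ s f) ∧
      (∀ s, KFun N₀ N₁ s f₀ ≤ C * KFun N₀ N₁ t f) ∧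
      (∀ s, 0 < s → KFun N₀ N₁ s f₁ ≤ ENNReal.ofReal (s / t) * (C * KFun N₀ N₁ t f)) ∧
      (∀ s, t ≤ s → KFun N₀ N₁ s f₁ ≤ C * KFun N₀ N₁ s f) := by
  obtain ⟨C, hC1, hC⟩ := exists_KFun_add_le h₀ h₁
  have hCone : (1 : ℝ≥0∞) ≤ C := by exact_mod_cast hC1
  have h2C : (2 : ℝ≥0∞) ≤ C * 3 := by
    calc (2 : ℝ≥0∞) ≤ 1 * 3 := by norm_num
      _ ≤ C * 3 := by gcongr
  refine ⟨C * 3, fun t ht f hf => ?_⟩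
  push_cast
  obtain ⟨f₀, f₁, hsum, hle⟩ : ∃ f₀ f₁ : V, f₀ + f₁ = f ∧
      N₀ f₀ + ENNReal.ofReal t * N₁ f₁ ≤ 2 * KFun N₀ N₁ t f := by
    -- The factor 2 leaves room above the infimum only when the infimum is nonzero; otherwise `f =
    -- 0`.
    by_cases hz : KFun N₀ N₁ t f = 0
    · have := eq_zero_of_KFun_eq_zero h₀ h₁ ht hz
      exact ⟨0, 0, by simp [this], by simp [h₀.map_zero, h₁.map_zero]⟩
    · have : KFun N₀ N₁ t f < 2 * KFun N₀ N₁ t f := by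
        rw [two_mul]
        exact ENNReal.lt_add_right hf.ne hz
      obtain ⟨f₀, f₁, h, h'⟩ := exists_decomposition_of_KFun_lt this
      exact ⟨f₀, f₁, h, h'.le⟩
  have ht' : ENNReal.ofReal t ≠ 0 := (ENNReal.ofReal_pos.2 ht).ne'
  have hA : ∀ s, KFun N₀ N₁ s f₀ ≤ 2 * KFun N₀ N₁ t f := fun s =>
    (KFun_le_left h₁ s f₀).trans (le_self_add.trans hle)
  have hle₁ : ENNReal.ofReal t * N₁ f₁ ≤ 2 * KFun N₀ N₁ t f := le_add_self.trans hle
  have hB : ∀ s, 0 < s → KFun N₀ N₁ s f₁ ≤ ENNReal.ofReal (s / t) * (2 * KFun N₀ N₁ t f) := by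
    intro s hs
    calc KFun N₀ N₁ s f₁ ≤ ENNReal.ofReal s * N₁ f₁ := KFun_le_right h₀ s f₁
      _ = ENNReal.ofReal (s / t) * (ENNReal.ofReal t * N₁ f₁) := by
          rw [← mul_assoc, ← ENNReal.ofReal_mul (by positivity), div_mul_cancel₀ _ ht.ne']
      _ ≤ _ := by gcongr
  refine ⟨f₀, f₁, hsum, fun s hs hst => ?_, fun s => ?_, fun s hs => ?_, fun s hts => ?_⟩
  -- To the left of `t` the piece `f₀` is controlled through `f - f₁`, because `K(s,f₁) ≤ 2 (s/t)
  -- K(t,f) ≤ 2 K(s,f)`. The roles are exchanged to the right of `t`.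
  · have e : f₀ = f + -f₁ := by rw [← hsum]; abel
    calc KFun N₀ N₁ s f₀ ≤ C * (KFun N₀ N₁ s f + KFun N₀ N₁ s f₁) := by
          conv_lhs => rw [e]
          simpa [KFun_neg h₀ h₁] using hC s f (-f₁)
      _ ≤ C * (KFun N₀ N₁ s f + 2 * KFun N₀ N₁ s f) := by
          gcongr
          refine (hB s hs).trans ?_
          rw [mul_left_comm]
          gcongr
          exact ofReal_div_mul_KFun_le f hs hst
      _ = _ := by ring
  · exact (hA s).trans (by gcongr)
  · exact (hB s hs).trans (by gcongr)
  · have e : f₁ = f + -f₀ := by rw [← hsum]; abel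
    calc KFun N₀ N₁ s f₁ ≤ C * (KFun N₀ N₁ s f + KFun N₀ N₁ s f₀) := by
          conv_lhs => rw [e]
          simpa [KFun_neg h₀ h₁] using hC s f (-f₀)
      _ ≤ C * (KFun N₀ N₁ s f + 2 * KFun N₀ N₁ s f) := by
          gcongr
          exact (hA s).trans (by gcongr; exact KFun_mono f hts)
      _ = _ := by ring

end KFunctional

/-- A Potter-type bound: the first inequality says that `t^(-ε) b(t)` is almost decreasing, the
second that `t^ε b(t)` is almost increasing. -/
theorem IsSlowlyVarying.exists_le_mul {b : ℝ → ℝ} (hb : IsSlowlyVarying b) {ε : ℝ} (hε : 0 < ε) :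
    ∃ M : ℝ, 0 < M ∧ ∀ s u : ℝ, 0 < s → s ≤ u →
      b u ≤ M * (u / s) ^ ε * b s ∧ b s ≤ M * (u / s) ^ ε * b u := by
  obtain ⟨g, hgpos, hgmono, c, C, hc, hC, hg⟩ := hb.equiv_monotone ε hε
  obtain ⟨h, hhpos, hhanti, d, D, hd, hD, hh⟩ := hb.equiv_antitone ε hε
  refine ⟨max (C / c) (D / d), lt_max_of_lt_left (by positivity), fun s u hs hsu => ?_⟩
  have hu : 0 < u := hs.trans_le hsu
  have hsε : 0 < s ^ ε := Real.rpow_pos_of_pos hs ε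
  have huε : 0 < u ^ ε := Real.rpow_pos_of_pos hu ε
  have hbs := hb.pos s hs
  have hbu := hb.pos u hu
  rw [Real.div_rpow hu.le hs.le]
  constructor
  · have h1 : u ^ (-ε) * b u ≤ D / d * (s ^ (-ε) * b s) := by
      calc u ^ (-ε) * b u ≤ D * h u := (hh u hu).2
        _ ≤ D * h s := by gcongr; exact hhanti hs hu hsu
        _ = D / d * (d * h s) := by field_simp
        _ ≤ _ := by gcongr ?_ * ?_; exact (hh s hs).1
    rw [Real.rpow_neg hu.le, Real.rpow_neg hs.le] at h1
    calc b u = u ^ ε * ((u ^ ε)⁻¹ * b u) := by field_simp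
      _ ≤ u ^ ε * (D / d * ((s ^ ε)⁻¹ * b s)) := by gcongr
      _ = D / d * (u ^ ε / s ^ ε) * b s := by field_simp
      _ ≤ _ := by gcongr; exact le_max_right _ _
  · have h1 : s ^ ε * b s ≤ C / c * (u ^ ε * b u) := by
      calc s ^ ε * b s ≤ C * g s := (hg s hs).2
        _ ≤ C * g u := by gcongr; exact hgmono hs hu hsu
        _ = C / c * (c * g u) := by field_simp
        _ ≤ _ := by gcongr ?_ * ?_; exact (hg u hu).1
    calc b s = (s ^ ε * b s) / s ^ ε := by field_simp
      _ ≤ (C / c * (u ^ ε * b u)) / s ^ ε := by gcongr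
      _ = C / c * (u ^ ε / s ^ ε) * b u := by field_simp
      _ ≤ _ := by gcongr; exact le_max_left _ _

/-! ### Tail integrals of slowly varying functions. -/

section Tail

variable {q : ℝ} {b : ℝ → ℝ}

theorem IsSV0.pos (hb : IsSV0 q b) {t : ℝ} (ht : 0 < t) : 0 < b t := hb.slowlyVarying.pos t ht

theorem IsSV0.density_pos (hb : IsSV0 q b) {t : ℝ} (ht : 0 < t) : 0 < b t ^ q / t :=
  div_pos (Real.rpow_pos_of_pos (hb.pos ht) q) ht

theorem IsSV0.aemeasurable_density (hb : IsSV0 q b) :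
    AEMeasurable (fun u => b u ^ q / u) (volume.restrict (Ioi 0)) :=
  (hb.slowlyVarying.aemeasurable.pow_const q).div measurable_id.aemeasurable

theorem IsSV0.integrableOn_Ioi (hq : 0 < q) (hb : IsSV0 q b) {t : ℝ} (ht : 0 < t) :
    IntegrableOn (fun u => b u ^ q / u) (Ioi t) := by
  -- Away from `0` the density is bounded, by comparing `b u` with `b 1`; the interval is empty for
  -- `t ≥ 1`.
  have h1 : IntegrableOn (fun u => b u ^ q / u) (Ioc t 1) := by
    obtain ⟨M, hM, h⟩ := hb.slowlyVarying.exists_le_mul one_pos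
    refine IntegrableOn.of_bound measure_Ioc_lt_top ?_ ((M * (1 / t) ^ (1 : ℝ) * b 1) ^ q / t) ?_
    · exact (hb.aemeasurable_density.mono_measure
        (Measure.restrict_mono (fun u (hu : u ∈ Ioc t 1) => ht.trans hu.1) le_rfl)).aestronglyMeasurable
    · filter_upwards [ae_restrict_mem measurableSet_Ioc] with u hu
      have hu0 : 0 < u := ht.trans hu.1
      have hb1 := hb.pos one_pos
      rw [Real.norm_of_nonneg (hb.density_pos hu0).le]
      refine div_le_div₀ (by positivity) ?_ ht hu.1.le
      refine Real.rpow_le_rpow (hb.pos hu0).le ((h u 1 hu0 hu.2).2.trans ?_) hq.le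
      gcongr
      exact hu.1.le
  refine (h1.union hb.integrable_tail).mono_set fun u hu => ?_
  rcases le_or_gt u 1 with h | h
  · exact Or.inl ⟨hu, h⟩
  · exact Or.inr h

theorem IsSV0.integrableOn_Ioc (hq : 0 < q) (hb : IsSV0 q b) {s : ℝ} (hs : 0 < s) (t : ℝ) :
    IntegrableOn (fun u => b u ^ q / u) (Ioc s t) :=
  (hb.integrableOn_Ioi hq hs).mono_set Ioc_subset_Ioi_self

theorem lintegral_density_Ioi (hq : 0 < q) (hb : IsSV0 q b) {t : ℝ} (ht : 0 < t) :
    ∫⁻ u in Ioi t, ENNReal.ofReal (b u ^ q / u) = ENNReal.ofReal (tail q b t) := by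
  rw [tail, ofReal_integral_eq_lintegral_ofReal (hb.integrableOn_Ioi hq ht)]
  filter_upwards [ae_restrict_mem measurableSet_Ioi] with u hu
  exact (hb.density_pos (ht.trans hu)).le

theorem tail_sub_tail (hq : 0 < q) (hb : IsSV0 q b) {s t : ℝ} (hs : 0 < s) (hst : s ≤ t) :
    tail q b s - tail q b t = ∫ u in s..t, b u ^ q / u := by
  rw [intervalIntegral.integral_of_le hst, tail, tail, ← Ioc_union_Ioi_eq_Ioi hst,
    setIntegral_union (Ioc_disjoint_Ioi le_rfl) measurableSet_Ioi (hb.integrableOn_Ioc hq hs t)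
      (hb.integrableOn_Ioi hq (hs.trans_le hst))]
  ring

theorem lintegral_density_Ioc (hq : 0 < q) (hb : IsSV0 q b) {s t : ℝ} (hs : 0 < s) (hst : s ≤ t) :
    ∫⁻ u in Ioc s t, ENNReal.ofReal (b u ^ q / u) =
      ENNReal.ofReal (tail q b s - tail q b t) := by
  rw [tail_sub_tail hq hb hs hst, intervalIntegral.integral_of_le hst,
    ofReal_integral_eq_lintegral_ofReal (hb.integrableOn_Ioc hq hs t)]
  filter_upwards [ae_restrict_mem measurableSet_Ioc] with u hu
  exact (hb.density_pos (hs.trans hu.1)).le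

theorem tail_strictAntiOn (hq : 0 < q) (hb : IsSV0 q b) : StrictAntiOn (tail q b) (Ioi 0) := by
  intro s hs t _ hst
  rw [← sub_pos, tail_sub_tail hq hb hs hst.le]
  refine intervalIntegral.intervalIntegral_pos_of_pos_on ?_ (fun u hu => ?_) hst
  · rw [intervalIntegrable_iff_integrableOn_Ioc_of_le hst.le]
    exact hb.integrableOn_Ioc hq hs t
  · exact hb.density_pos (hs.trans hu.1)

theorem tail_nonneg (hb : IsSV0 q b) {t : ℝ} (ht : 0 < t) : 0 ≤ tail q b t :=
  setIntegral_nonneg measurableSet_Ioi fun _ hu => (hb.density_pos (ht.trans hu)).le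

theorem tail_pos (hq : 0 < q) (hb : IsSV0 q b) {t : ℝ} (ht : 0 < t) : 0 < tail q b t :=
  (tail_nonneg hb (ht.trans (lt_add_one t))).trans_lt
    (tail_strictAntiOn hq hb ht (ht.trans (lt_add_one t)) (lt_add_one t))

theorem tail_absolutelyContinuousOnInterval (hq : 0 < q) (hb : IsSV0 q b) {s t : ℝ} (hs : 0 < s)
    (hst : s ≤ t) : AbsolutelyContinuousOnInterval (tail q b) s t := by
  have h1 : AbsolutelyContinuousOnInterval (fun x => ∫ v in t..x, b v ^ q / v) s t :=
    IntervalIntegrable.absolutelyContinuousOnInterval_intervalIntegral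
      ((intervalIntegrable_iff_integrableOn_Ioc_of_le hst).2 (hb.integrableOn_Ioc hq hs t)) (by simp)
  have h2 : AbsolutelyContinuousOnInterval (fun _ : ℝ => tail q b t) s t :=
    (LipschitzWith.const (tail q b t)).lipschitzOnWith.absolutelyContinuousOnInterval
  rw [absolutelyContinuousOnInterval_iff] at *
  intro ε hε
  obtain ⟨δ, hδ, h⟩ := h1 ε hε
  refine ⟨δ, hδ, fun E hE hlt => ?_⟩
  convert h E hE hlt using 2 with i hi
  have hmem := hE.1 i hi
  rw [uIcc_of_le hst] at hmem
  have key : ∀ x ∈ Icc s t, tail q b x = tail q b t - ∫ v in t..x, b v ^ q / v := fun x hx => by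
    rw [intervalIntegral.integral_symm, ← tail_sub_tail hq hb (hs.trans_le hx.1) hx.2]
    ring
  rw [key _ hmem.1, key _ hmem.2, dist_sub_left]

theorem tail_continuousOn (hq : 0 < q) (hb : IsSV0 q b) : ContinuousOn (tail q b) (Ioi 0) := by
  intro x (hx : 0 < x)
  have h := (tail_absolutelyContinuousOnInterval hq hb (half_pos hx)
    (show x / 2 ≤ 2 * x by linarith)).continuousOn
  rw [uIcc_of_le (by linarith)] at h
  exact (h.continuousAt (Icc_mem_nhds (by linarith) (by linarith))).continuousWithinAt

theorem tail_tendsto_atTop (hq : 0 < q) (hb : IsSV0 q b) : Tendsto (tail q b) atTop (𝓝 0) := by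
  have h := intervalIntegral_tendsto_integral_Ioi (1 : ℝ) (hb.integrableOn_Ioi hq one_pos) tendsto_id
  have h2 := (tendsto_const_nhds (x := tail q b 1)).sub h
  rw [tail, sub_self] at h2
  refine h2.congr' ?_
  filter_upwards [eventually_ge_atTop 1] with t ht
  rw [id, ← tail_sub_tail hq hb one_pos ht, tail]
  ring

theorem ae_hasDerivAt_tail (hq : 0 < q) (hb : IsSV0 q b) {s t : ℝ} (hs : 0 < s) (hst : s < t) :
    ∀ᵐ x, x ∈ Icc s t → HasDerivAt (tail q b) (-(b x ^ q / x)) x := by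
  -- The interval is enlarged so that the integral formula for the tail holds in a neighbourhood of
  -- every point of `[s,t]`, endpoints included.
  have hs2 : 0 < s / 2 := half_pos hs
  have hst2 : s / 2 ≤ t + 1 := by linarith
  have hint : IntervalIntegrable (fun u => b u ^ q / u) volume (s / 2) (t + 1) :=
    (intervalIntegrable_iff_integrableOn_Ioc_of_le hst2).2 (hb.integrableOn_Ioc hq hs2 _)
  filter_upwards [hint.ae_hasDerivAt_integral] with x hx hxm
  rw [uIcc_of_le hst2] at hx
  have hx' := hx ⟨by linarith [hxm.1], by linarith [hxm.2]⟩ (s / 2) ⟨le_rfl, hst2⟩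
  refine (hx'.const_sub (tail q b (s / 2))).congr_of_eventuallyEq ?_
  filter_upwards [Ioi_mem_nhds (show s / 2 < x by linarith [hxm.1])] with y hy
  rw [← tail_sub_tail hq hb hs2 (le_of_lt hy)]
  ring

/-- This controls a function that grows at most linearly on `(0,t]`. Slow variation bounds the
integral by a multiple of `b(t)^q`, and `b(t)^q` is in turn bounded by the mass of the density on
`(t,2t]`. -/
theorem exists_lintegral_density_mul_le (hq : 0 < q) (hb : IsSV0 q b) :
    ∃ C : ℝ≥0, ∀ t : ℝ, 0 < t →
      ∫⁻ s in Ioc 0 t, ENNReal.ofReal (b s ^ q / s) * ENNReal.ofReal (s / t) ^ q ≤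
        C * ENNReal.ofReal (tail q b t) := by
  -- Any exponent below 1 would do; with `1/2` the remaining integrand is `s^(q/2-1)`, integrable at
  -- `0`.
  obtain ⟨M, hM, h⟩ := hb.slowlyVarying.exists_le_mul (half_pos one_pos)
  -- On `(t,2t]` the first factor compares `b t` with `b u`, and the last 2 compares `1/t` with
  -- `1/u`.
  set D : ℝ := (M * 2 ^ (1 / 2 : ℝ)) ^ q * 2 with hD
  have hDpos : 0 < D := by positivity
  have hlow : ∀ t : ℝ, 0 < t → b t ^ q ≤ D * tail q b t := by
    intro t ht
    have hbt := hb.pos ht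
    have h1 : ∫ u in Ioc t (2 * t), D⁻¹ * (b t ^ q / t) ≤ ∫ u in Ioc t (2 * t), b u ^ q / u := by
      refine setIntegral_mono_on (integrableOn_const measure_Ioc_lt_top.ne)
        (hb.integrableOn_Ioc hq ht _) measurableSet_Ioc fun u hu => ?_
      have hu0 : 0 < u := ht.trans hu.1
      have hbu := hb.pos hu0
      have h2 : b t ≤ M * 2 ^ (1 / 2 : ℝ) * b u := by
        refine (h t u ht hu.1.le).2.trans ?_
        gcongr
        rw [div_le_iff₀ ht]
        exact hu.2
      have h3 : b t ^ q ≤ (M * 2 ^ (1 / 2 : ℝ)) ^ q * b u ^ q := by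
        rw [← Real.mul_rpow (by positivity) hbu.le]
        exact Real.rpow_le_rpow hbt.le h2 hq.le
      rw [inv_mul_le_iff₀ hDpos, hD, div_le_iff₀ ht]
      have h4 : 1 ≤ 2 * (t / u) := by
        rw [← mul_div_assoc, le_div_iff₀ hu0]
        linarith [hu.2]
      calc b t ^ q ≤ (M * 2 ^ (1 / 2 : ℝ)) ^ q * b u ^ q := h3
        _ ≤ ((M * 2 ^ (1 / 2 : ℝ)) ^ q * b u ^ q) * (2 * (t / u)) :=
          le_mul_of_one_le_right (by positivity) h4
        _ = _ := by field_simp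
    have h5 : ∫ u in Ioc t (2 * t), b u ^ q / u ≤ tail q b t :=
      setIntegral_mono_set (hb.integrableOn_Ioi hq ht)
        (by
          filter_upwards [ae_restrict_mem measurableSet_Ioi] with u hu
          exact (hb.density_pos (ht.trans hu)).le) Ioc_subset_Ioi_self.eventuallyLE
    rw [setIntegral_const, Measure.real, Real.volume_Ioc,
      ENNReal.toReal_ofReal (by linarith), smul_eq_mul] at h1
    have h6 : D⁻¹ * b t ^ q ≤ tail q b t := by
      refine le_trans (le_of_eq ?_) (h1.trans h5)
      field_simp
      ring
    rwa [inv_mul_le_iff₀ hDpos] at h6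
  have hq2 : (-1 : ℝ) < q / 2 - 1 := by linarith
  refine ⟨(M ^ q * (D * (2 / q))).toNNReal, fun t ht => ?_⟩
  have hbt := hb.pos ht
  have hint : ∫⁻ s in Ioc (0 : ℝ) t, ENNReal.ofReal (s ^ (q / 2 - 1)) =
      ENNReal.ofReal (t ^ (q / 2) * (2 / q)) := by
    have h1 := intervalIntegral.intervalIntegrable_rpow' (a := 0) (b := t) hq2
    rw [intervalIntegrable_iff_integrableOn_Ioc_of_le ht.le] at h1
    rw [← ofReal_integral_eq_lintegral_ofReal h1, ← intervalIntegral.integral_of_le ht.le,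
      integral_rpow (Or.inl hq2)]
    · rw [sub_add_cancel, Real.zero_rpow (by positivity), sub_zero]
      congr 1
      field_simp
    · filter_upwards [ae_restrict_mem measurableSet_Ioc] with u hu
      exact Real.rpow_nonneg hu.1.le _
  calc ∫⁻ s in Ioc 0 t, ENNReal.ofReal (b s ^ q / s) * ENNReal.ofReal (s / t) ^ q
      ≤ ∫⁻ s in Ioc 0 t, ENNReal.ofReal (M ^ q * b t ^ q / t ^ (q / 2)) *
          ENNReal.ofReal (s ^ (q / 2 - 1)) := by
        refine setLIntegral_mono_ae' measurableSet_Ioc (ae_of_all _ fun s hs => ?_)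
        have hs0 : 0 < s := hs.1
        have hbs := hb.pos hs0
        rw [ENNReal.ofReal_rpow_of_nonneg (by positivity) hq.le,
          ← ENNReal.ofReal_mul (by positivity), ← ENNReal.ofReal_mul (by positivity)]
        refine ENNReal.ofReal_le_ofReal ?_
        have h1 : b s ^ q ≤ M ^ q * (t ^ (q / 2) / s ^ (q / 2)) * b t ^ q := by
          refine (Real.rpow_le_rpow hbs.le (h s t hs0 hs.2).2 hq.le).trans (le_of_eq ?_)
          rw [Real.mul_rpow (by positivity) hbt.le, Real.mul_rpow hM.le (by positivity),
            ← Real.rpow_mul (by positivity), Real.div_rpow ht.le hs0.le,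
            show 1 / 2 * q = q / 2 by ring]
        have h2 : s ^ q = s ^ (q / 2) * s ^ (q / 2) := by
          rw [← Real.rpow_add hs0, add_halves]
        have h3 : t ^ q = t ^ (q / 2) * t ^ (q / 2) := by
          rw [← Real.rpow_add ht, add_halves]
        rw [Real.div_rpow hs0.le ht.le, Real.rpow_sub_one hs0.ne', h2, h3]
        calc b s ^ q / s * (s ^ (q / 2) * s ^ (q / 2) / (t ^ (q / 2) * t ^ (q / 2)))
            ≤ (M ^ q * (t ^ (q / 2) / s ^ (q / 2)) * b t ^ q) / s *
              (s ^ (q / 2) * s ^ (q / 2) / (t ^ (q / 2) * t ^ (q / 2))) := by gcongr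
          _ = _ := by
            have := (Real.rpow_pos_of_pos hs0 (q / 2)).ne'
            have := (Real.rpow_pos_of_pos ht (q / 2)).ne'
            field_simp
    _ = ENNReal.ofReal (M ^ q * b t ^ q / t ^ (q / 2)) *
          ENNReal.ofReal (t ^ (q / 2) * (2 / q)) := by
        rw [lintegral_const_mul' _ _ ENNReal.ofReal_ne_top, hint]
    _ = ENNReal.ofReal (M ^ q * b t ^ q * (2 / q)) := by
        rw [← ENNReal.ofReal_mul (by positivity)]
        congr 1
        have := (Real.rpow_pos_of_pos ht (q / 2)).ne'
        field_simp
    _ ≤ ENNReal.ofReal (M ^ q * (D * (2 / q)) * tail q b t) := by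
        refine ENNReal.ofReal_le_ofReal ?_
        calc M ^ q * b t ^ q * (2 / q) ≤ M ^ q * (D * tail q b t) * (2 / q) := by
              gcongr
              exact hlow t ht
          _ = _ := by ring
    _ = _ := by
        rw [ENNReal.ofReal_mul (by positivity)]
        rfl

end Tail

/-! ### Discrete Hardy inequality. -/

section Hardy

/-- Split `r = η²`: one factor `η^i` makes the series summable, and the other enters a supremum of
`η^i d_i`, which is at most an `ℓ^s` norm. No convexity is involved, so `s < 1` is allowed. -/
theorem exists_rpow_tsum_geometric_mul_le {r : ℝ≥0∞} (hr : r < 1) {s : ℝ} (hs : 0 < s) :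
    ∃ C δ : ℝ≥0∞, C < ∞ ∧ δ < 1 ∧ ∀ d : ℕ → ℝ≥0∞,
      (∑' i, r ^ i * d i) ^ s ≤ C * ∑' i, δ ^ i * d i ^ s := by
  obtain ⟨η, hη1, hηη⟩ : ∃ η : ℝ≥0∞, η < 1 ∧ r = η * η :=
    ⟨r ^ (1 / 2 : ℝ), ENNReal.rpow_lt_one hr (by norm_num), by
      rw [← ENNReal.rpow_add_of_nonneg _ _ (by norm_num) (by norm_num)]
      norm_num⟩
  have hA : ∑' i : ℕ, η ^ i < ∞ := by
    rw [ENNReal.tsum_geometric]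
    exact ENNReal.inv_lt_top.2 (tsub_pos_of_lt hη1)
  refine ⟨(∑' i : ℕ, η ^ i) ^ s, η ^ s, ENNReal.rpow_lt_top_of_nonneg hs.le hA.ne,
    ENNReal.rpow_lt_one hη1 hs, fun d => ?_⟩
  have hsup : ∀ i, η ^ i * d i ≤ (∑' j, (η ^ j * d j) ^ s) ^ (1 / s) := fun i => by
    rw [one_div, ENNReal.le_rpow_inv_iff hs]
    exact ENNReal.le_tsum i
  calc (∑' i, r ^ i * d i) ^ s
      ≤ (∑' i, η ^ i * (∑' j, (η ^ j * d j) ^ s) ^ (1 / s)) ^ s := by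
        refine ENNReal.rpow_le_rpow (ENNReal.tsum_le_tsum fun i => ?_) hs.le
        rw [hηη, mul_pow, mul_assoc]
        gcongr
        exact hsup i
    _ = (∑' i : ℕ, η ^ i) ^ s * ∑' j, (η ^ j * d j) ^ s := by
        rw [ENNReal.tsum_mul_right, ENNReal.mul_rpow_of_nonneg _ _ hs.le, ← ENNReal.rpow_mul,
          one_div_mul_cancel hs.ne', ENNReal.rpow_one]
    _ = _ := by
        congr 1
        refine tsum_congr fun i => ?_
        rw [ENNReal.mul_rpow_of_nonneg _ _ hs.le, ← ENNReal.rpow_natCast, ← ENNReal.rpow_natCast,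
          ← ENNReal.rpow_mul, ← ENNReal.rpow_mul, mul_comm s]

/-- A discrete Hardy inequality for weights with geometric growth along the shifts `σ`. -/
theorem exists_tsum_weighted_le {r D : ℝ≥0∞} (hr : r < 1) (hD : D < ∞) {p q : ℝ} (hp : 0 < p)
    (hq : 0 < q) :
    ∃ C : ℝ≥0∞, C < ∞ ∧ ∀ (σ : ℕ → ℤ ≃ ℤ) (w a : ℤ → ℝ≥0∞),
      (∀ i k, w k ≤ D * r ^ i * w (σ i k)) →
      ∑' k, (w k * (∑' i, a (σ i k) ^ p) ^ (1 / p)) ^ q ≤ C * ∑' k, (w k * a k) ^ q := by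
  have hqp : 0 < q / p := div_pos hq hp
  obtain ⟨C, δ, hC, hδ, h⟩ := exists_rpow_tsum_geometric_mul_le (ENNReal.rpow_lt_one hr hp) hqp
  have hG : ∑' i : ℕ, δ ^ i < ∞ := by
    rw [ENNReal.tsum_geometric]
    exact ENNReal.inv_lt_top.2 (tsub_pos_of_lt hδ)
  refine ⟨D ^ q * (C * ∑' i : ℕ, δ ^ i),
    ENNReal.mul_lt_top (ENNReal.rpow_lt_top_of_nonneg hq.le hD.ne) (ENNReal.mul_lt_top hC hG),
    fun σ w a hw => ?_⟩
  have hterm : ∀ k, (w k * (∑' i, a (σ i k) ^ p) ^ (1 / p)) ^ q ≤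
      D ^ q * (C * ∑' i, δ ^ i * (w (σ i k) * a (σ i k)) ^ q) := by
    intro k
    calc (w k * (∑' i, a (σ i k) ^ p) ^ (1 / p)) ^ q
        = (∑' i, (w k * a (σ i k)) ^ p) ^ (q / p) := by
          -- At the level of `p`-th powers the inner expression becomes a geometric series, and the
          -- previous lemma applies with exponent `q / p`.
          have e : (w k * (∑' i, a (σ i k) ^ p) ^ (1 / p)) ^ p = ∑' i, (w k * a (σ i k)) ^ p := by
            rw [ENNReal.mul_rpow_of_nonneg _ _ hp.le, ← ENNReal.rpow_mul,
              one_div_mul_cancel hp.ne', ENNReal.rpow_one, ← ENNReal.tsum_mul_left]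
            exact tsum_congr fun i => (ENNReal.mul_rpow_of_nonneg _ _ hp.le).symm
          rw [← e, ← ENNReal.rpow_mul, mul_div_cancel₀ _ hp.ne']
      _ ≤ (∑' i, D ^ p * ((r ^ p) ^ i * (w (σ i k) * a (σ i k)) ^ p)) ^ (q / p) := by
          gcongr with i
          calc (w k * a (σ i k)) ^ p ≤ (D * r ^ i * w (σ i k) * a (σ i k)) ^ p := by
                gcongr
                exact hw i k
            _ = _ := by
                rw [mul_assoc, mul_assoc, ENNReal.mul_rpow_of_nonneg _ _ hp.le,
                  ENNReal.mul_rpow_of_nonneg _ _ hp.le, ← ENNReal.rpow_natCast,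
                  ← ENNReal.rpow_natCast, ← ENNReal.rpow_mul, ← ENNReal.rpow_mul, mul_comm p]
      _ = D ^ q * (∑' i, (r ^ p) ^ i * (w (σ i k) * a (σ i k)) ^ p) ^ (q / p) := by
          rw [ENNReal.tsum_mul_left, ENNReal.mul_rpow_of_nonneg _ _ hqp.le, ← ENNReal.rpow_mul,
            mul_div_cancel₀ _ hp.ne']
      _ ≤ _ := by
          gcongr
          refine (h _).trans_eq ?_
          congr 1
          refine tsum_congr fun i => ?_
          rw [← ENNReal.rpow_mul, mul_div_cancel₀ _ hp.ne']
  -- After exchanging the sums, each `σ i` is a bijection of `ℤ`, so the sum over `k` no longer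
  -- depends on `i`.
  calc _ ≤ ∑' k, D ^ q * (C * ∑' i, δ ^ i * (w (σ i k) * a (σ i k)) ^ q) :=
        ENNReal.tsum_le_tsum hterm
    _ = D ^ q * (C * ∑' i : ℕ, ∑' k, δ ^ i * (w (σ i k) * a (σ i k)) ^ q) := by
        rw [ENNReal.tsum_mul_left, ENNReal.tsum_mul_left, ENNReal.tsum_comm]
    _ = D ^ q * (C * ∑' i : ℕ, δ ^ i * ∑' k, (w k * a k) ^ q) := by
        congr 3
        ext i
        rw [ENNReal.tsum_mul_left, (σ i).tsum_eq (fun k => (w k * a k) ^ q)]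
    _ = _ := by
        rw [ENNReal.tsum_mul_right]
        ring

end Hardy

/-! ### Integrals of monotone functions over a bi-infinite partition. -/

section Partition

variable {t : ℤ → ℝ}

theorem iUnion_Ioc_int_eq_Ioi (hmono : Monotone t) (hpos : ∀ k, 0 < t k)
    (hlt : ∀ x, 0 < x → ∃ k, t k < x) (hle : ∀ x, ∃ k, x ≤ t k) :
    ⋃ k, Ioc (t k) (t (k + 1)) = Ioi 0 := by
  ext x
  rw [mem_iUnion]
  refine ⟨fun ⟨k, hk⟩ => (hpos k).trans hk.1, fun hx => ?_⟩
  obtain ⟨n, hn⟩ := hle x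
  obtain ⟨k, hk, hmax⟩ := Int.exists_greatest_of_bdd (P := fun k => t k < x)
    ⟨n, fun z hz => (hmono.reflect_lt (hz.trans_le hn)).le⟩ (hlt x hx)
  exact ⟨k, hk, not_lt.1 fun h => by have := hmax _ h; omega⟩

theorem lintegral_Ioi_eq_tsum_Ioc (hmono : Monotone t)
    (hcover : ⋃ k, Ioc (t k) (t (k + 1)) = Ioi 0) (F : ℝ → ℝ≥0∞) :
    ∫⁻ u in Ioi 0, F u = ∑' k, ∫⁻ u in Ioc (t k) (t (k + 1)), F u := by
  rw [← hcover, lintegral_iUnion (fun _ => measurableSet_Ioc)]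
  exact hmono.pairwise_disjoint_on_Ioc_succ

theorem lintegral_mul_le_tsum (hmono : Monotone t)
    (hcover : ⋃ k, Ioc (t k) (t (k + 1)) = Ioi 0) {v F : ℝ → ℝ≥0∞} (hF : Monotone F)
    (hfin : ∀ k, F (t k) ≠ ∞) :
    ∫⁻ u in Ioi 0, v u * F u ≤ ∑' k, (∫⁻ u in Ioc (t k) (t (k + 1)), v u) * F (t (k + 1)) := by
  rw [lintegral_Ioi_eq_tsum_Ioc hmono hcover]
  refine ENNReal.tsum_le_tsum fun k => ?_
  -- Finiteness of the constant makes up for the measurability of `v`, which is not assumed.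
  rw [← lintegral_mul_const' _ _ (hfin _)]
  refine setLIntegral_mono_ae' measurableSet_Ioc (ae_of_all _ fun u hu => ?_)
  gcongr
  exact hF hu.2

theorem tsum_le_lintegral_mul (hmono : Monotone t)
    (hcover : ⋃ k, Ioc (t k) (t (k + 1)) = Ioi 0) {v F : ℝ → ℝ≥0∞} (hF : Monotone F) :
    ∑' k, (∫⁻ u in Ioc (t k) (t (k + 1)), v u) * F (t k) ≤ ∫⁻ u in Ioi 0, v u * F u := by
  rw [lintegral_Ioi_eq_tsum_Ioc hmono hcover]
  refine ENNReal.tsum_le_tsum fun k => (lintegral_mul_const_le _ _).trans ?_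
  refine setLIntegral_mono_ae' measurableSet_Ioc (ae_of_all _ fun u hu => ?_)
  gcongr
  exact hF hu.1.le

end Partition

/-! ### Quasi-monotonicity of `ρ_ε` and the range of the tail. -/

section

/-- The logarithm is Lipschitz with constant `1/m` on `[m,∞)`. -/
theorem absolutelyContinuousOnInterval_log {f : ℝ → ℝ} {a b : ℝ}
    (hf : AbsolutelyContinuousOnInterval f a b) {m : ℝ} (hm : 0 < m) (hfm : ∀ x ∈ uIcc a b, m ≤ f x) :
    AbsolutelyContinuousOnInterval (fun x => Real.log (f x)) a b := by
  have key : ∀ x y : ℝ, m ≤ x → m ≤ y → Real.log x - Real.log y ≤ m⁻¹ * |x - y| := by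
    intro x y hx hy
    have hx0 := hm.trans_le hx
    have hy0 := hm.trans_le hy
    rw [← Real.log_div hx0.ne' hy0.ne']
    calc Real.log (x / y) ≤ x / y - 1 := Real.log_le_sub_one_of_pos (by positivity)
      _ = y⁻¹ * (x - y) := by field_simp
      _ ≤ y⁻¹ * |x - y| := by gcongr; exact le_abs_self _
      _ ≤ _ := by gcongr
  rw [absolutelyContinuousOnInterval_iff] at *
  intro ε hε
  obtain ⟨δ, hδ, h⟩ := hf (m * ε) (by positivity)
  refine ⟨δ, hδ, fun E hE hlt => ?_⟩
  calc _ ≤ ∑ i ∈ Finset.range E.1, m⁻¹ * dist (f (E.2 i).1) (f (E.2 i).2) := by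
        refine Finset.sum_le_sum fun i hi => ?_
        have hmem := hE.1 i hi
        rw [Real.dist_eq, Real.dist_eq, abs_le']
        refine ⟨key _ _ (hfm _ hmem.1) (hfm _ hmem.2), ?_⟩
        rw [neg_sub, abs_sub_comm]
        exact key _ _ (hfm _ hmem.2) (hfm _ hmem.1)
    _ = m⁻¹ * ∑ i ∈ Finset.range E.1, dist (f (E.2 i).1) (f (E.2 i).2) := by rw [Finset.mul_sum]
    _ < m⁻¹ * (m * ε) := by gcongr; exact h E hE hlt
    _ = ε := by field_simp

variable {q₀ q₁ : ℝ} {b₀ b₁ : ℝ → ℝ}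

theorem tailNorm_pos {q : ℝ} {b : ℝ → ℝ} (hq : 0 < q) (hb : IsSV0 q b) {t : ℝ} (ht : 0 < t) :
    0 < tailNorm q b t := Real.rpow_pos_of_pos (tail_pos hq hb ht) _

theorem tailNorm_anti {q : ℝ} {b : ℝ → ℝ} (hq : 0 < q) (hb : IsSV0 q b) {s t : ℝ} (hs : 0 < s)
    (hst : s ≤ t) : tailNorm q b t ≤ tailNorm q b s :=
  Real.rpow_le_rpow (tail_nonneg hb (hs.trans_le hst))
    ((tail_strictAntiOn hq hb).antitoneOn hs (hs.trans_le hst) hst) (by positivity)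

theorem EquivNondecreasing.exists_le_mul {F : ℝ → ℝ} (h : EquivNondecreasing F) :
    ∃ M : ℝ, 0 < M ∧ ∀ s t : ℝ, 0 < s → s ≤ t → F s ≤ M * F t := by
  obtain ⟨g, hg, c, C, hc, hC, h⟩ := h
  refine ⟨C / c, by positivity, fun s t hs hst => ?_⟩
  have ht := hs.trans_le hst
  calc F s ≤ C * g s := (h s hs).2
    _ ≤ C * g t := by gcongr; exact hg hs ht hst
    _ = C / c * (c * g t) := by field_simp
    _ ≤ _ := by gcongr; exact (h t ht).1

theorem deriv_rho_div_rho {p : ℝ} (hp : 0 < p) (hb₀ : IsSV0 p b₀) (hb₁ : IsSV0 p b₁) {t : ℝ}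
    (ht : 0 < t) (h₀ : HasDerivAt (tail p b₀) (-(b₀ t ^ p / t)) t)
    (h₁ : HasDerivAt (tail p b₁) (-(b₁ t ^ p / t)) t) :
    deriv (rho p p b₀ b₁) t / rho p p b₀ b₁ t =
      1 / p * (b₁ t ^ p / t / tail p b₁ t - b₀ t ^ p / t / tail p b₀ t) := by
  have hF := tail_pos hp hb₀ ht
  have hG := tail_pos hp hb₁ ht
  have hF' := Real.rpow_pos_of_pos hF (1 / p)
  have hG' := Real.rpow_pos_of_pos hG (1 / p)
  have hd := (h₀.rpow_const (p := 1 / p) (Or.inl hF.ne')).div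
    (h₁.rpow_const (p := 1 / p) (Or.inl hG.ne')) hG'.ne'
  have hd' : deriv (rho p p b₀ b₁) t = _ := hd.deriv
  rw [hd', rho, tailNorm, tailNorm, Real.rpow_sub_one hF.ne', Real.rpow_sub_one hG.ne']
  field_simp
  ring

/-- Let `T_j` be the tails and `g_j = -T_j'/T_j`. Since `ρ'/ρ = (g₁ - g₀)/p`, the hypothesis says
`g₀ ≤ (1 - c p) g₁` almost everywhere. Integrating with some `κ < 1` shows that `T₀ / T₁^κ` is
non-decreasing, and `ρ_ε` with `1 + ε = 1/κ` is a positive power of this quotient. -/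
theorem exists_rhoEps_le_of_deriv {p : ℝ} (hp : 0 < p) (hb₀ : IsSV0 p b₀) (hb₁ : IsSV0 p b₁) {c : ℝ}
    (hc : 0 < c)
    (h : ∀ᵐ t ∂(volume.restrict (Ioi (0 : ℝ))), c * (t⁻¹ * b₁ t ^ p / tail p b₁ t) ≤
      deriv (rho p p b₀ b₁) t / rho p p b₀ b₁ t) :
    ∃ ε : ℝ, 0 < ε ∧ ∀ s t : ℝ, 0 < s → s ≤ t → rhoEps ε p p b₀ b₁ s ≤ rhoEps ε p p b₀ b₁ t := by
  -- The value `1 - c p` may be nonpositive; the `1/2` keeps `κ` invertible.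
  set κ : ℝ := max (1 / 2) (1 - c * p) with hκ
  have hκ0 : 0 < κ := lt_max_of_lt_left (by norm_num)
  have hκ1 : κ < 1 := max_lt (by norm_num) (by have := mul_pos hc hp; linarith)
  have hκc : 1 - c * p ≤ κ := le_max_right _ _
  refine ⟨1 / κ - 1, by rw [sub_pos, lt_div_iff₀ hκ0]; linarith, fun s t hs hst => ?_⟩
  have ht := hs.trans_le hst
  have hlog : Real.log (tail p b₀ s) - κ * Real.log (tail p b₁ s) ≤
      Real.log (tail p b₀ t) - κ * Real.log (tail p b₁ t) := by
    rcases hst.eq_or_lt with rfl | hlt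
    · exact le_rfl
    have hac : ∀ {b : ℝ → ℝ}, IsSV0 p b →
        AbsolutelyContinuousOnInterval (fun x => Real.log (tail p b x)) s t := fun {b} hb =>
      absolutelyContinuousOnInterval_log (tail_absolutelyContinuousOnInterval hp hb hs hst)
        (tail_pos hp hb ht) fun x hx => by
          rw [uIcc_of_le hst] at hx
          exact (tail_strictAntiOn hp hb).antitoneOn (hs.trans_le hx.1) ht hx.2
    -- Absolute continuity is what lets an almost-everywhere sign of the derivative imply
    -- monotonicity.
    have hint := ((hac hb₀).sub ((hac hb₁).const_mul κ)).integral_deriv_eq_sub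
    have hnn : 0 ≤ ∫ x in s..t, deriv ((fun x => Real.log (tail p b₀ x)) -
        fun x => κ * Real.log (tail p b₁ x)) x := by
      refine intervalIntegral.integral_nonneg_of_ae_restrict hst ?_
      have h' := ae_restrict_of_ae_restrict_of_subset
        (show Icc s t ⊆ Ioi 0 from fun x hx => hs.trans_le hx.1) h
      filter_upwards [h', ae_restrict_mem measurableSet_Icc,
        ae_restrict_of_ae (ae_hasDerivAt_tail hp hb₀ hs hlt),
        ae_restrict_of_ae (ae_hasDerivAt_tail hp hb₁ hs hlt)] with x hx hxm h₀ h₁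
      have hx0 : 0 < x := hs.trans_le hxm.1
      have hF := tail_pos hp hb₀ hx0
      have hG := tail_pos hp hb₁ hx0
      rw [deriv_rho_div_rho hp hb₀ hb₁ hx0 (h₀ hxm) (h₁ hxm)] at hx
      have hd := ((h₀ hxm).log hF.ne').sub (((h₁ hxm).log hG.ne').const_mul κ)
      have hd' : deriv ((fun x => Real.log (tail p b₀ x)) -
        fun x => κ * Real.log (tail p b₁ x)) x = _ := hd.deriv
      rw [hd']
      have hg : 0 ≤ b₁ x ^ p / x / tail p b₁ x := div_nonneg (hb₁.density_pos hx0).le hG.le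
      have e : x⁻¹ * b₁ x ^ p / tail p b₁ x = b₁ x ^ p / x / tail p b₁ x := by
        rw [inv_mul_eq_div]
      rw [e, one_div, inv_mul_eq_div, le_div_iff₀ hp] at hx
      have := mul_le_mul_of_nonneg_right hκc hg
      simp only [Pi.zero_apply, neg_div]
      nlinarith
    rw [hint] at hnn
    simp only [Pi.sub_apply] at hnn
    linarith
  have hform : ∀ x : ℝ, 0 < x → rhoEps (1 / κ - 1) p p b₀ b₁ x =
      Real.exp ((Real.log (tail p b₀ x) - κ * Real.log (tail p b₁ x)) * (1 / (p * κ))) := by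
    intro x hx
    have hF := tail_pos hp hb₀ hx
    have hG := tail_pos hp hb₁ hx
    rw [rhoEps, tailNorm, tailNorm, ← Real.rpow_mul hF.le, Real.rpow_def_of_pos hF,
      Real.rpow_def_of_pos hG, ← Real.exp_sub]
    congr 1
    field_simp
    ring
  rw [hform s hs, hform t ht]
  gcongr

/-- Unequal and equal exponents are brought to one common property, from which the partition is
built. -/
theorem exists_rhoEps_le (hq₀ : 0 < q₀) (hq₁ : 0 < q₁) (hb₀ : IsSV0 q₀ b₀) (hb₁ : IsSV0 q₁ b₁)
    (h_ne : q₀ ≠ q₁ → ∃ ε : ℝ, 0 < ε ∧ EquivNondecreasing (rhoEps ε q₀ q₁ b₀ b₁))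
    (h_eq : q₀ = q₁ → ∃ c : ℝ, 0 < c ∧ ∀ᵐ t ∂(volume.restrict (Ioi (0 : ℝ))),
      c * (t⁻¹ * b₁ t ^ q₁ / tail q₁ b₁ t) ≤
        deriv (rho q₀ q₁ b₀ b₁) t / rho q₀ q₁ b₀ b₁ t) :
    ∃ ε M : ℝ, 0 < ε ∧ 0 < M ∧ ∀ s t : ℝ, 0 < s → s ≤ t →
      rhoEps ε q₀ q₁ b₀ b₁ s ≤ M * rhoEps ε q₀ q₁ b₀ b₁ t := by
  by_cases hq : q₀ = q₁
  · subst hq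
    obtain ⟨c, hc, h⟩ := h_eq rfl
    obtain ⟨ε, hε, h⟩ := exists_rhoEps_le_of_deriv hq₀ hb₀ hb₁ hc h
    exact ⟨ε, 1, hε, one_pos, by simpa using h⟩
  · obtain ⟨ε, hε, h⟩ := h_ne hq
    obtain ⟨M, hM, h⟩ := h.exists_le_mul
    exact ⟨ε, M, hε, hM, h⟩

theorem exists_tail_eq (hq : 0 < q₁) (hb₁ : IsSV0 q₁ b₁)
    (h0 : ∀ y : ℝ, ∃ t : ℝ, 0 < t ∧ y ≤ tail q₁ b₁ t) {y : ℝ} (hy : 0 < y) :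
    ∃ t : ℝ, 0 < t ∧ tail q₁ b₁ t = y := by
  obtain ⟨s, hs, hsy⟩ := h0 y
  obtain ⟨u, hu0, huy⟩ := ((eventually_gt_atTop (0 : ℝ)).and
    ((tail_tendsto_atTop hq hb₁).eventually_lt_const hy)).exists
  obtain ⟨t, ht, h⟩ := isPreconnected_Ioi.intermediate_value (show u ∈ Ioi (0 : ℝ) from hu0)
    (show s ∈ Ioi (0 : ℝ) from hs) (tail_continuousOn hq hb₁) ⟨huy.le, hsy⟩
  exact ⟨t, ht, h⟩

/-- The tail of `b₁` is unbounded near `0`: there `ρ` tends to `0` although its numerator stays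
above its value at `1`. -/
theorem exists_le_tail (hq₀ : 0 < q₀) (hq₁ : 0 < q₁) (hb₀ : IsSV0 q₀ b₀) (hb₁ : IsSV0 q₁ b₁)
    (hρ_zero : Tendsto (rho q₀ q₁ b₀ b₁) (𝓝[>] 0) (𝓝 0)) (y : ℝ) :
    ∃ t : ℝ, 0 < t ∧ y ≤ tail q₁ b₁ t := by
  set z : ℝ := max y 1 with hz
  have hz0 : 0 < z := lt_max_of_lt_right one_pos
  have hB := tailNorm_pos hq₀ hb₀ one_pos
  have hzq := Real.rpow_pos_of_pos hz0 (1 / q₁)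
  obtain ⟨t, ht, ht0, ht1⟩ := ((hρ_zero.eventually_lt_const (div_pos hB hzq)).and
    (Ioo_mem_nhdsGT one_pos)).exists
  refine ⟨t, ht0, (le_max_left _ _).trans (show z ≤ _ from ?_)⟩
  have hN := tailNorm_pos hq₁ hb₁ ht0
  rw [rho, div_lt_div_iff₀ hN hzq] at ht
  have h1 : z ^ (1 / q₁) < tailNorm q₁ b₁ t := by
    have := mul_le_mul_of_nonneg_right (tailNorm_anti hq₀ hb₀ ht0 ht1.le) hzq.le
    exact lt_of_mul_lt_mul_left (this.trans_lt ht) hB.le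
  exact ((Real.rpow_lt_rpow_iff hz0.le (tail_nonneg hb₁ ht0) (by positivity)).1 h1).le

end

/-! ### Existence of the geometric partition. -/

section

/-- A bi-infinite partition of `(0,∞)` along which the tail of `b₁` decays geometrically and `ρ`
grows geometrically, both with ratios that are bounded above and below. -/
structure IsGeometricPartition (q₀ q₁ : ℝ) (b₀ b₁ : ℝ → ℝ) (Λ : ℝ) (t : ℤ → ℝ) : Prop where
  one_lt : 1 < Λ
  pos : ∀ k, 0 < t k
  mono : Monotone t
  cover : ⋃ k, Ioc (t k) (t (k + 1)) = Ioi 0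
  tail_succ : ∀ k, Λ ^ q₁ * tail q₁ b₁ (t (k + 1)) = tail q₁ b₁ (t k)
  two_mul_rho_le : ∀ k, 2 * rho q₀ q₁ b₀ b₁ (t k) ≤ rho q₀ q₁ b₀ b₁ (t (k + 1))
  rho_succ_le : ∀ k, rho q₀ q₁ b₀ b₁ (t (k + 1)) ≤ Λ * rho q₀ q₁ b₀ b₁ (t k)
  rho_cover : ⋃ k, Ioc (rho q₀ q₁ b₀ b₁ (t k)) (rho q₀ q₁ b₀ b₁ (t (k + 1))) = Ioi 0

variable {q₀ q₁ : ℝ} {b₀ b₁ : ℝ → ℝ}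

theorem rho_pos (hq₀ : 0 < q₀) (hq₁ : 0 < q₁) (hb₀ : IsSV0 q₀ b₀) (hb₁ : IsSV0 q₁ b₁)
    {t : ℝ} (ht : 0 < t) : 0 < rho q₀ q₁ b₀ b₁ t :=
  div_pos (tailNorm_pos hq₀ hb₀ ht) (tailNorm_pos hq₁ hb₁ ht)

theorem rho_mul_tailNorm (hq₁ : 0 < q₁) (hb₁ : IsSV0 q₁ b₁) {t : ℝ} (ht : 0 < t) :
    rho q₀ q₁ b₀ b₁ t * tailNorm q₁ b₁ t = tailNorm q₀ b₀ t :=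
  div_mul_cancel₀ _ (tailNorm_pos hq₁ hb₁ ht).ne'

theorem mul_tailNorm_eq {q : ℝ} {b : ℝ → ℝ} (hq : 0 < q) (hb : IsSV0 q b) {Λ s t : ℝ} (hΛ : 0 < Λ)
    (ht : 0 < t) (h : Λ ^ q * tail q b t = tail q b s) :
    Λ * tailNorm q b t = tailNorm q b s := by
  rw [tailNorm, tailNorm, ← h, Real.mul_rpow (by positivity) (tail_nonneg hb ht),
    ← Real.rpow_mul hΛ.le, mul_one_div_cancel hq.ne', Real.rpow_one]

theorem exists_isGeometricPartition (hq₀ : 0 < q₀) (hq₁ : 0 < q₁) (hb₀ : IsSV0 q₀ b₀)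
    (hb₁ : IsSV0 q₁ b₁) (hρ_mono : MonotoneOn (rho q₀ q₁ b₀ b₁) (Ioi 0))
    (hρ_zero : Tendsto (rho q₀ q₁ b₀ b₁) (𝓝[>] 0) (𝓝 0))
    (hρ_top : Tendsto (rho q₀ q₁ b₀ b₁) atTop atTop) {ε M : ℝ} (hε : 0 < ε) (hM : 0 < M)
    (h : ∀ s t : ℝ, 0 < s → s ≤ t →
      rhoEps ε q₀ q₁ b₀ b₁ s ≤ M * rhoEps ε q₀ q₁ b₀ b₁ t) :
    ∃ (Λ : ℝ) (t : ℤ → ℝ), IsGeometricPartition q₀ q₁ b₀ b₁ Λ t := by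
  -- The 2 gives `Λ > 1`; the other term gives `2^(1+ε) M ≤ Λ^ε`, which is what the doubling of `ρ`
  -- needs.
  set Λ : ℝ := max 2 ((2 ^ (1 + ε) * M) ^ (1 / ε)) with hΛdef
  have hΛ1 : 1 < Λ := lt_max_of_lt_left (by norm_num)
  have hΛ0 : 0 < Λ := one_pos.trans hΛ1
  have hΛε : 2 ^ (1 + ε) * M ≤ Λ ^ ε := by
    have h1 : (2 ^ (1 + ε) * M) ^ (1 / ε) ≤ Λ := le_max_right _ _
    have h2 := Real.rpow_le_rpow (by positivity) h1 hε.le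
    rwa [← Real.rpow_mul (by positivity), one_div_mul_cancel hε.ne', Real.rpow_one] at h2
  have hpow1 : 1 < Λ ^ q₁ := Real.one_lt_rpow hΛ1 hq₁
  have hpow0 : 0 < Λ ^ q₁ := one_pos.trans hpow1
  -- The tail of `b₁` takes every positive value, so all integer powers of `Λ^q₁` are attained, the
  -- large ones near `0`.
  have hex : ∀ k : ℤ, ∃ t : ℝ, 0 < t ∧ tail q₁ b₁ t = (Λ ^ q₁) ^ (-k) := fun k =>
    exists_tail_eq hq₁ hb₁ (exists_le_tail hq₀ hq₁ hb₀ hb₁ hρ_zero) (zpow_pos hpow0 _)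
  choose t htpos htail using hex
  have hanti := tail_strictAntiOn hq₁ hb₁
  have hmono : Monotone t := fun k l hkl => by
    rw [← hanti.le_iff_ge (htpos l) (htpos k), htail, htail]
    exact zpow_le_zpow_right₀ hpow1.le (by omega)
  have htsucc : ∀ k, Λ ^ q₁ * tail q₁ b₁ (t (k + 1)) = tail q₁ b₁ (t k) := fun k => by
    rw [htail, htail, ← zpow_one_add₀ hpow0.ne']
    congr 1
    ring
  have hnsucc : ∀ k, Λ * tailNorm q₁ b₁ (t (k + 1)) = tailNorm q₁ b₁ (t k) := fun k =>
    mul_tailNorm_eq hq₁ hb₁ hΛ0 (htpos _) (htsucc k)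
  have hlt : ∀ x : ℝ, 0 < x → ∃ k, t k < x := fun x hx => by
    obtain ⟨n, hn⟩ := pow_unbounded_of_one_lt (tail q₁ b₁ x) hpow1
    refine ⟨-n, ?_⟩
    rw [← hanti.lt_iff_gt hx (htpos _), htail]
    simpa using hn
  have hle : ∀ x : ℝ, ∃ k, x ≤ t k := fun x => by
    have hx : 0 < max x 1 := lt_max_of_lt_right one_pos
    obtain ⟨n, hn⟩ := exists_pow_lt_of_lt_one (tail_pos hq₁ hb₁ hx) (inv_lt_one_of_one_lt₀ hpow1)
    refine ⟨n, (le_max_left x 1).trans ?_⟩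
    rw [← hanti.le_iff_ge (htpos _) hx, htail]
    simpa using hn.le
  -- Dividing out `N₁(t_k) = Λ N₁(t_{k+1})`, quasi-monotonicity of `ρ_ε` reads `N₀(t_k)^(1+ε) ≤ M Λ
  -- N₀(t_{k+1})^(1+ε)`. The choice of `Λ` turns this into `2 N₀(t_k) ≤ Λ N₀(t_{k+1})`, which is the
  -- doubling of `ρ`.
  have htwo : ∀ k, 2 * rho q₀ q₁ b₀ b₁ (t k) ≤ rho q₀ q₁ b₀ b₁ (t (k + 1)) := fun k => by
    have hn := tailNorm_pos hq₁ hb₁ (htpos k)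
    have hn' := tailNorm_pos hq₁ hb₁ (htpos (k + 1))
    have hm := tailNorm_pos hq₀ hb₀ (htpos k)
    have hm' := tailNorm_pos hq₀ hb₀ (htpos (k + 1))
    have h1 := h (t k) (t (k + 1)) (htpos k) (hmono (by omega))
    rw [rhoEps, rhoEps, ← hnsucc k, div_le_iff₀ (by positivity)] at h1
    have h2 : tailNorm q₀ b₀ (t k) ^ (1 + ε) ≤
        M * Λ * tailNorm q₀ b₀ (t (k + 1)) ^ (1 + ε) := by
      refine h1.trans (le_of_eq ?_)
      field_simp
    have h3 : (2 * tailNorm q₀ b₀ (t k)) ^ (1 + ε) ≤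
        (Λ * tailNorm q₀ b₀ (t (k + 1))) ^ (1 + ε) := by
      rw [Real.mul_rpow (by norm_num) hm.le, Real.mul_rpow hΛ0.le hm'.le]
      calc 2 ^ (1 + ε) * tailNorm q₀ b₀ (t k) ^ (1 + ε)
          ≤ 2 ^ (1 + ε) * (M * Λ * tailNorm q₀ b₀ (t (k + 1)) ^ (1 + ε)) := by gcongr
        _ = (2 ^ (1 + ε) * M) * Λ * tailNorm q₀ b₀ (t (k + 1)) ^ (1 + ε) := by ring
        _ ≤ Λ ^ ε * Λ * tailNorm q₀ b₀ (t (k + 1)) ^ (1 + ε) := by gcongr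
        _ = _ := by rw [Real.rpow_one_add' hΛ0.le (by positivity), mul_comm Λ]
    have h4 := (Real.rpow_le_rpow_iff (by positivity) (by positivity) (by positivity)).1 h3
    rw [rho, rho, ← hnsucc k, ← mul_div_assoc, div_le_div_iff₀ (by positivity) hn']
    nlinarith
  have hrpos : ∀ k, 0 < rho q₀ q₁ b₀ b₁ (t k) := fun k => rho_pos hq₀ hq₁ hb₀ hb₁ (htpos k)
  have hrmono : Monotone fun k => rho q₀ q₁ b₀ b₁ (t k) := fun k l hkl =>
    hρ_mono (htpos k) (htpos l) (hmono hkl)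
  refine ⟨Λ, t, hΛ1, htpos, hmono, iUnion_Ioc_int_eq_Ioi hmono htpos hlt hle, htsucc, htwo,
    fun k => ?_, iUnion_Ioc_int_eq_Ioi hrmono hrpos (fun x hx => ?_) (fun x => ?_)⟩
  · have hn' := tailNorm_pos hq₁ hb₁ (htpos (k + 1))
    rw [rho, rho, ← hnsucc k, ← mul_div_assoc, mul_div_mul_left _ _ hΛ0.ne']
    gcongr
    exact tailNorm_anti hq₀ hb₀ (htpos k) (hmono (by omega))
  · obtain ⟨s, hs, hs0⟩ := ((hρ_zero.eventually_lt_const hx).and self_mem_nhdsWithin).exists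
    obtain ⟨k, hk⟩ := hlt s hs0
    exact ⟨k, (hρ_mono (htpos k) hs0 hk.le).trans_lt hs⟩
  · obtain ⟨s, hs, hs0⟩ := ((hρ_top.eventually_ge_atTop x).and (eventually_gt_atTop 0)).exists
    obtain ⟨k, hk⟩ := hle s
    exact ⟨k, hs.trans (hρ_mono hs0 (htpos k) hk)⟩

/-! ### Power decay of the interpolation weight. -/

section Weight

variable {b : ℝ → ℝ} {θ : ℝ}

/-- Half of the power `θ`, respectively `1 - θ`, is spent on the slow variation of `b`; the other
half remains as decay. -/
theorem IsSlowlyVarying.exists_weight_le (hb : IsSlowlyVarying b) (hθ₀ : 0 < θ) (hθ₁ : θ < 1) :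
    ∃ M : ℝ, 0 < M ∧ ∀ s u : ℝ, 0 < s → s ≤ u →
      u ^ (-θ) * b u ≤ M * (s / u) ^ (θ / 2) * (s ^ (-θ) * b s) ∧
      s * (s ^ (-θ) * b s) ≤ M * (s / u) ^ ((1 - θ) / 2) * (u * (u ^ (-θ) * b u)) := by
  obtain ⟨M₁, hM₁, h₁⟩ := hb.exists_le_mul (half_pos hθ₀)
  obtain ⟨M₂, hM₂, h₂⟩ := hb.exists_le_mul (half_pos (sub_pos.2 hθ₁))
  refine ⟨max M₁ M₂, lt_max_of_lt_left hM₁, fun s u hs hsu => ?_⟩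
  have hu : 0 < u := hs.trans_le hsu
  have hbs := hb.pos s hs
  have hbu := hb.pos u hu
  constructor
  · calc u ^ (-θ) * b u ≤ u ^ (-θ) * (M₁ * (u / s) ^ (θ / 2) * b s) := by
          gcongr
          exact (h₁ s u hs hsu).1
      _ = M₁ * (s / u) ^ (θ / 2) * (s ^ (-θ) * b s) := by
          have e1 : s ^ (-θ) = s ^ (-(θ / 2)) * s ^ (-(θ / 2)) := by
            rw [← Real.rpow_add hs]; ring_nf
          have e2 : u ^ (-θ) = u ^ (-(θ / 2)) * u ^ (-(θ / 2)) := by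
            rw [← Real.rpow_add hu]; ring_nf
          have := (Real.rpow_pos_of_pos hs (θ / 2)).ne'
          have := (Real.rpow_pos_of_pos hu (θ / 2)).ne'
          rw [e1, e2, Real.div_rpow hu.le hs.le, Real.div_rpow hs.le hu.le, Real.rpow_neg hs.le,
            Real.rpow_neg hu.le]
          field_simp
      _ ≤ _ := by gcongr; exact le_max_left _ _
  · calc s * (s ^ (-θ) * b s) ≤ s * (s ^ (-θ) * (M₂ * (u / s) ^ ((1 - θ) / 2) * b u)) := by
          gcongr
          exact (h₂ s u hs hsu).2
      _ = M₂ * (s / u) ^ ((1 - θ) / 2) * (u * (u ^ (-θ) * b u)) := by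
          have e : ∀ x : ℝ, 0 < x → x * x ^ (-θ) = x ^ ((1 - θ) / 2) * x ^ ((1 - θ) / 2) := by
            intro x hx
            rw [← Real.rpow_add hx, ← Real.rpow_one_add' hx.le (by linarith)]
            ring_nf
          have := (Real.rpow_pos_of_pos hs ((1 - θ) / 2)).ne'
          have := (Real.rpow_pos_of_pos hu ((1 - θ) / 2)).ne'
          rw [← mul_assoc s, ← mul_assoc u, e s hs, e u hu, Real.div_rpow hu.le hs.le,
            Real.div_rpow hs.le hu.le]
          field_simp
      _ ≤ _ := by gcongr; exact le_max_right _ _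

end Weight

/-! ### Lower estimate for the K-functional of the limiting couple. -/

section Norms

variable {V : Type*} [AddCommGroup V] {N₀ N₁ : V → ℝ≥0∞}

theorem interpNorm_rpow {θ q : ℝ} (hq : 0 < q) {b : ℝ → ℝ} (hb : ∀ t, 0 < t → 0 < b t) (f : V) :
    interpNorm N₀ N₁ θ q b f ^ q =
      ∫⁻ s in Ioi (0 : ℝ), ENNReal.ofReal ((s ^ (-θ) * b s) ^ q / s) * KFun N₀ N₁ s f ^ q := by
  rw [interpNorm, ← ENNReal.rpow_mul, one_div_mul_cancel hq.ne', ENNReal.rpow_one]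
  refine setLIntegral_congr_fun measurableSet_Ioi fun s hs => ?_
  have hs0 : 0 < s := hs
  have hbs := hb s hs
  rw [ENNReal.mul_rpow_of_nonneg _ _ hq.le, ENNReal.ofReal_rpow_of_nonneg (by positivity) hq.le,
    Real.rpow_sub hs0, div_mul_eq_mul_div, Real.div_rpow (by positivity) (by positivity),
    ← Real.rpow_mul hs0.le, one_div_mul_cancel hq.ne', Real.rpow_one]

theorem interpNorm_zero_rpow {q : ℝ} (hq : 0 < q) {b : ℝ → ℝ} (hb : ∀ t, 0 < t → 0 < b t) (f : V) :
    interpNorm N₀ N₁ 0 q b f ^ q =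
      ∫⁻ s in Ioi (0 : ℝ), ENNReal.ofReal (b s ^ q / s) * KFun N₀ N₁ s f ^ q := by
  simpa using interpNorm_rpow (θ := 0) hq hb f

theorem ofReal_tailNorm_rpow {q : ℝ} {b : ℝ → ℝ} (hq : 0 < q) (hb : IsSV0 q b) {t : ℝ}
    (ht : 0 < t) : ENNReal.ofReal (tailNorm q b t) ^ q = ENNReal.ofReal (tail q b t) := by
  rw [ENNReal.ofReal_rpow_of_nonneg (tailNorm_pos hq hb ht).le hq.le, tailNorm,
    ← Real.rpow_mul (tail_nonneg hb ht), one_div_mul_cancel hq.ne', Real.rpow_one]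

/-- Restrict the integral to `(t,∞)`, where the K-functional is at least its value at `t`. -/
theorem tailNorm_mul_KFun_le_interpNorm {q : ℝ} {b : ℝ → ℝ} (hq : 0 < q) (hb : IsSV0 q b) {t : ℝ}
    (ht : 0 < t) (f : V) :
    ENNReal.ofReal (tailNorm q b t) * KFun N₀ N₁ t f ≤ interpNorm N₀ N₁ 0 q b f := by
  rw [← ENNReal.rpow_le_rpow_iff hq, ENNReal.mul_rpow_of_nonneg _ _ hq.le,
    ofReal_tailNorm_rpow hq hb ht, interpNorm_zero_rpow hq (fun _ => hb.pos),
    ← lintegral_density_Ioi hq hb ht]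
  calc _ ≤ ∫⁻ s in Ioi t, ENNReal.ofReal (b s ^ q / s) * KFun N₀ N₁ t f ^ q :=
        lintegral_mul_const_le _ _
    _ ≤ ∫⁻ s in Ioi t, ENNReal.ofReal (b s ^ q / s) * KFun N₀ N₁ s f ^ q := by
        refine setLIntegral_mono_ae' measurableSet_Ioi (ae_of_all _ fun u hu => ?_)
        gcongr
        exact KFun_mono f (le_of_lt hu)
    _ ≤ _ := lintegral_mono_set (Ioi_subset_Ioi ht.le)

variable {𝕜 : Type*} [RCLike 𝕜] [Module 𝕜 V] [TopologicalSpace V]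

/-- For any decomposition `f = g₀ + g₁`, bound `K(t,g_j)` by the norm of `g_j` divided by `N_j(t)`;
since `N₀ = ρ N₁`, the second piece acquires exactly the factor `ρ(t)`. -/
theorem exists_tailNorm_mul_KFun_le (h₀ : IsEmbeddedQuasiNorm 𝕜 N₀) (h₁ : IsEmbeddedQuasiNorm 𝕜 N₁)
    (hq₀ : 0 < q₀) (hq₁ : 0 < q₁) (hb₀ : IsSV0 q₀ b₀) (hb₁ : IsSV0 q₁ b₁) :
    ∃ C : ℝ≥0, ∀ t : ℝ, 0 < t → ∀ f : V,
      ENNReal.ofReal (tailNorm q₀ b₀ t) * KFun N₀ N₁ t f ≤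
        C * KFun (interpNorm N₀ N₁ 0 q₀ b₀) (interpNorm N₀ N₁ 0 q₁ b₁) (rho q₀ q₁ b₀ b₁ t) f := by
  obtain ⟨C, hC1, hC⟩ := exists_KFun_add_le h₀ h₁
  have hC0 : (C : ℝ≥0∞) ≠ 0 := by exact_mod_cast (zero_lt_one.trans_le hC1).ne'
  refine ⟨C, fun t ht f => ?_⟩
  rw [← ENNReal.div_le_iff' hC0 ENNReal.coe_ne_top]
  refine le_KFun fun g₀ g₁ hg => ?_
  rw [ENNReal.div_le_iff' hC0 ENNReal.coe_ne_top]
  calc ENNReal.ofReal (tailNorm q₀ b₀ t) * KFun N₀ N₁ t f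
      ≤ ENNReal.ofReal (tailNorm q₀ b₀ t) * (C * (KFun N₀ N₁ t g₀ + KFun N₀ N₁ t g₁)) := by
        gcongr
        rw [← hg]
        exact hC t g₀ g₁
    _ = C * (ENNReal.ofReal (tailNorm q₀ b₀ t) * KFun N₀ N₁ t g₀ +
          ENNReal.ofReal (rho q₀ q₁ b₀ b₁ t) *
            (ENNReal.ofReal (tailNorm q₁ b₁ t) * KFun N₀ N₁ t g₁)) := by
        rw [← mul_assoc (ENNReal.ofReal (rho q₀ q₁ b₀ b₁ t)),
          ← ENNReal.ofReal_mul (rho_pos hq₀ hq₁ hb₀ hb₁ ht).le, rho_mul_tailNorm hq₁ hb₁ ht]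
        ring
    _ ≤ _ := by
        gcongr
        · exact tailNorm_mul_KFun_le_interpNorm hq₀ hb₀ ht g₀
        · exact tailNorm_mul_KFun_le_interpNorm hq₁ hb₁ ht g₁

end Norms

end

/-! ### Passing between integrals and sums over partition blocks. -/

section PartitionSums

variable {t : ℤ → ℝ} {q : ℝ} {v F : ℝ → ℝ≥0∞} {A : ℤ → ℝ≥0∞} {C : ℝ≥0∞}

/-- On each block the increasing `F` is replaced by its value at the right endpoint, hence the index
`k + 1`, which a shift of `ℤ` removes. -/
theorem lintegral_mul_rpow_le (hq : 0 < q) (hmono : Monotone t)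
    (hcover : ⋃ k, Ioc (t k) (t (k + 1)) = Ioi 0) (hF : Monotone F) (hfin : ∀ k, F (t k) ≠ ∞)
    (h : ∀ k, ∫⁻ u in Ioc (t k) (t (k + 1)), v u ≤ C * A (k + 1) ^ q) :
    ∫⁻ u in Ioi 0, v u * F u ^ q ≤ C * ∑' k, (A k * F (t k)) ^ q := by
  have hF' : Monotone fun u => F u ^ q := fun x y hxy => ENNReal.rpow_le_rpow (hF hxy) hq.le
  calc _ ≤ ∑' k, (∫⁻ u in Ioc (t k) (t (k + 1)), v u) * F (t (k + 1)) ^ q :=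
        lintegral_mul_le_tsum hmono hcover hF' fun k =>
          (ENNReal.rpow_lt_top_of_nonneg hq.le (hfin k)).ne
    _ ≤ ∑' k, C * (A (k + 1) * F (t (k + 1))) ^ q := by
        refine ENNReal.tsum_le_tsum fun k => ?_
        rw [ENNReal.mul_rpow_of_nonneg _ _ hq.le, ← mul_assoc]
        gcongr
        exact h k
    _ = _ := by
        rw [ENNReal.tsum_mul_left]
        congr 1
        exact (Equiv.addRight (1 : ℤ)).tsum_eq fun k => (A k * F (t k)) ^ q

theorem tsum_mul_rpow_le (hq : 0 < q) (hmono : Monotone t)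
    (hcover : ⋃ k, Ioc (t k) (t (k + 1)) = Ioi 0) (hF : Monotone F)
    (h : ∀ k, A k ^ q ≤ C * ∫⁻ u in Ioc (t k) (t (k + 1)), v u) :
    ∑' k, (A k * F (t k)) ^ q ≤ C * ∫⁻ u in Ioi 0, v u * F u ^ q := by
  have hF' : Monotone fun u => F u ^ q := fun x y hxy => ENNReal.rpow_le_rpow (hF hxy) hq.le
  calc _ ≤ ∑' k, C * ((∫⁻ u in Ioc (t k) (t (k + 1)), v u) * F (t k) ^ q) := by
        refine ENNReal.tsum_le_tsum fun k => ?_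
        rw [ENNReal.mul_rpow_of_nonneg _ _ hq.le, ← mul_assoc]
        gcongr
        exact h k
    _ ≤ _ := by
        rw [ENNReal.tsum_mul_left]
        gcongr
        exact tsum_le_lintegral_mul hmono hcover hF'

variable {b : ℝ → ℝ} {Λ : ℝ}

theorem lintegral_density_mul_Ioc_le (hq : 0 < q) (hb : IsSV0 q b)
    (hpos : ∀ k, 0 < t k) (hΛ : 0 ≤ Λ)
    (hn : ∀ k, tailNorm q b (t k) ≤ Λ * tailNorm q b (t (k + 1)))
    (hF : Monotone F) (hfin : ∀ k, F (t k) ≠ ∞) (j : ℤ) :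
    ∫⁻ u in Ioc (t j) (t (j + 1)), ENNReal.ofReal (b u ^ q / u) * F u ^ q ≤
      (ENNReal.ofReal Λ * (ENNReal.ofReal (tailNorm q b (t (j + 1))) * F (t (j + 1)))) ^ q := by
  calc _ ≤ ∫⁻ u in Ioc (t j) (t (j + 1)), ENNReal.ofReal (b u ^ q / u) * F (t (j + 1)) ^ q := by
        refine setLIntegral_mono_ae' measurableSet_Ioc (ae_of_all _ fun u hu => ?_)
        gcongr
        exact hF hu.2
    _ = (∫⁻ u in Ioc (t j) (t (j + 1)), ENNReal.ofReal (b u ^ q / u)) * F (t (j + 1)) ^ q :=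
        lintegral_mul_const' _ _ (ENNReal.rpow_lt_top_of_nonneg hq.le (hfin _)).ne
    _ ≤ ENNReal.ofReal (tailNorm q b (t j)) ^ q * F (t (j + 1)) ^ q := by
        gcongr
        rw [ofReal_tailNorm_rpow hq hb (hpos j), ← lintegral_density_Ioi hq hb (hpos j)]
        exact lintegral_mono_set Ioc_subset_Ioi_self
    _ ≤ _ := by
        rw [← ENNReal.mul_rpow_of_nonneg _ _ hq.le, ← mul_assoc, ← ENNReal.ofReal_mul hΛ]
        gcongr
        exact hn j

theorem lintegral_density_mul_Ioc_zero_le (hq : 0 < q) (hb : IsSV0 q b) (hmono : Monotone t)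
    (hpos : ∀ k, 0 < t k) (hcover : ⋃ k, Ioc (t k) (t (k + 1)) = Ioi 0) (hΛ : 0 ≤ Λ)
    (hn : ∀ k, tailNorm q b (t k) ≤ Λ * tailNorm q b (t (k + 1)))
    (hF : Monotone F) (hfin : ∀ k, F (t k) ≠ ∞) (k : ℤ) :
    ∫⁻ u in Ioc 0 (t k), ENNReal.ofReal (b u ^ q / u) * F u ^ q ≤
      ∑' i : ℕ, (ENNReal.ofReal Λ *
        (ENNReal.ofReal (tailNorm q b (t (k - i))) * F (t (k - i)))) ^ q := by
  have hsub : Ioc 0 (t k) ⊆ ⋃ i : ℕ, Ioc (t (k - i - 1)) (t (k - i - 1 + 1)) := fun x hx => by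
    have hx' : x ∈ ⋃ k, Ioc (t k) (t (k + 1)) := hcover ▸ hx.1
    obtain ⟨j, hj⟩ := mem_iUnion.1 hx'
    have hjk : j < k := hmono.reflect_lt (hj.1.trans_le hx.2)
    refine mem_iUnion.2 ⟨(k - 1 - j).toNat, ?_⟩
    rwa [show k - ((k - 1 - j).toNat : ℤ) - 1 = j by omega]
  refine (lintegral_mono_set hsub).trans ((lintegral_iUnion_le _ _).trans
    (ENNReal.tsum_le_tsum fun i => ?_))
  refine (lintegral_density_mul_Ioc_le hq hb hpos hΛ hn hF hfin _).trans_eq ?_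
  rw [sub_add_cancel]

theorem lintegral_density_mul_Ioi_le (hq : 0 < q) (hb : IsSV0 q b) (hmono : Monotone t)
    (hpos : ∀ k, 0 < t k) (hcover : ⋃ k, Ioc (t k) (t (k + 1)) = Ioi 0) (hΛ : 0 ≤ Λ)
    (hn : ∀ k, tailNorm q b (t k) ≤ Λ * tailNorm q b (t (k + 1)))
    (hF : Monotone F) (hfin : ∀ k, F (t k) ≠ ∞) (k : ℤ) :
    ∫⁻ u in Ioi (t k), ENNReal.ofReal (b u ^ q / u) * F u ^ q ≤
      ∑' i : ℕ, (ENNReal.ofReal Λ *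
        (ENNReal.ofReal (tailNorm q b (t (k + i))) * F (t (k + i)))) ^ q := by
  have hsub : Ioi (t k) ⊆ ⋃ i : ℕ, Ioc (t (k + i)) (t (k + i + 1)) := fun x (hx : t k < x) => by
    have hx' : x ∈ ⋃ k, Ioc (t k) (t (k + 1)) := hcover ▸ (hpos k).trans hx
    obtain ⟨j, hj⟩ := mem_iUnion.1 hx'
    have hjk : k < j + 1 := hmono.reflect_lt (hx.trans_le hj.2)
    refine mem_iUnion.2 ⟨(j - k).toNat, ?_⟩
    rwa [show k + ((j - k).toNat : ℤ) = j by omega]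
  set G : ℕ → ℝ≥0∞ := fun i => (ENNReal.ofReal Λ *
        (ENNReal.ofReal (tailNorm q b (t (k + i))) * F (t (k + i)))) ^ q with hG
  -- Right endpoints start at index `k + 1`; the term `i = 0` is added for free.
  calc _ ≤ ∑' i : ℕ, G (i + 1) := by
        refine (lintegral_mono_set hsub).trans ((lintegral_iUnion_le _ _).trans
          (ENNReal.tsum_le_tsum fun i => ?_))
        refine (lintegral_density_mul_Ioc_le hq hb hpos hΛ hn hF hfin _).trans_eq ?_
        simp only [hG, Nat.cast_add, Nat.cast_one, add_assoc]
    _ ≤ ∑' i, G i := ENNReal.tsum_comp_le_tsum_of_injective (add_left_injective 1) G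

end PartitionSums

/-! ### Upper, Holmstedt-type estimate for the K-functional of the limiting couple. -/

section Upper

variable {V : Type*} [AddCommGroup V] {N₀ N₁ : V → ℝ≥0∞} {𝕜 : Type*} [RCLike 𝕜] [Module 𝕜 V]
  [TopologicalSpace V] [IsTopologicalAddGroup V] [T2Space V] {q₀ q₁ : ℝ} {b₀ b₁ : ℝ → ℝ}
  {Λ : ℝ} {t : ℤ → ℝ}

theorem IsGeometricPartition.tailNorm_right (hP : IsGeometricPartition q₀ q₁ b₀ b₁ Λ t)
    (hq₁ : 0 < q₁) (hb₁ : IsSV0 q₁ b₁) (k : ℤ) :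
    Λ * tailNorm q₁ b₁ (t (k + 1)) = tailNorm q₁ b₁ (t k) :=
  mul_tailNorm_eq hq₁ hb₁ (one_pos.trans hP.one_lt) (hP.pos _) (hP.tail_succ k)

theorem IsGeometricPartition.rho_le_succ (hP : IsGeometricPartition q₀ q₁ b₀ b₁ Λ t) (hq₀ : 0 < q₀)
    (hq₁ : 0 < q₁) (hb₀ : IsSV0 q₀ b₀) (hb₁ : IsSV0 q₁ b₁) (k : ℤ) :
    rho q₀ q₁ b₀ b₁ (t k) ≤ rho q₀ q₁ b₀ b₁ (t (k + 1)) := by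
  have := hP.two_mul_rho_le k
  have := rho_pos hq₀ hq₁ hb₀ hb₁ (hP.pos k)
  linarith

theorem IsGeometricPartition.tailNorm_left (hP : IsGeometricPartition q₀ q₁ b₀ b₁ Λ t)
    (hq₀ : 0 < q₀) (hq₁ : 0 < q₁) (hb₀ : IsSV0 q₀ b₀) (hb₁ : IsSV0 q₁ b₁) (k : ℤ) :
    tailNorm q₀ b₀ (t k) ≤ Λ * tailNorm q₀ b₀ (t (k + 1)) := by
  rw [← rho_mul_tailNorm (q₀ := q₀) (b₀ := b₀) hq₁ hb₁ (hP.pos k),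
    ← rho_mul_tailNorm (q₀ := q₀) (b₀ := b₀) hq₁ hb₁ (hP.pos (k + 1)),
    ← hP.tailNorm_right hq₁ hb₁ k, mul_left_comm]
  have := one_pos.trans hP.one_lt
  have := tailNorm_pos hq₁ hb₁ (hP.pos (k + 1))
  gcongr
  exact hP.rho_le_succ hq₀ hq₁ hb₀ hb₁ k

theorem rho_sub_natCast_le (hP : IsGeometricPartition q₀ q₁ b₀ b₁ Λ t) (i : ℕ) (k : ℤ) :
    rho q₀ q₁ b₀ b₁ (t (k - i)) ≤ (1 / 2) ^ i * rho q₀ q₁ b₀ b₁ (t k) := by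
  induction i with
  | zero => simp
  | succ i ih =>
    have h := hP.two_mul_rho_le (k - i - 1)
    rw [sub_add_cancel] at h
    rw [Nat.cast_add, Nat.cast_one, ← sub_sub, pow_succ]
    linarith

theorem lintegral_Ioi_zero_eq_add {a : ℝ} (ha : 0 ≤ a) (f : ℝ → ℝ≥0∞) :
    ∫⁻ u in Ioi 0, f u = (∫⁻ u in Ioc 0 a, f u) + ∫⁻ u in Ioi a, f u := by
  rw [← Ioc_union_Ioi_eq_Ioi ha, lintegral_union measurableSet_Ioi (Ioc_disjoint_Ioi le_rfl)]

/-- Test the infimum with a nearly optimal decomposition at `t_k`. To the left, `K(·,f₀)` is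
controlled by `K(·,f)` and `K(·,f₁)` by a linear function; to the right, `K(·,f₀)` is bounded by a
constant and `K(·,f₁)` is controlled by `K(·,f)`. The parts governed by `K(·,f)` give the sums over
blocks, and the other two only cost a term with `i = 0`. -/
theorem exists_KFun_rho_le (h₀ : IsEmbeddedQuasiNorm 𝕜 N₀) (h₁ : IsEmbeddedQuasiNorm 𝕜 N₁)
    (hq₀ : 0 < q₀) (hq₁ : 0 < q₁) (hb₀ : IsSV0 q₀ b₀) (hb₁ : IsSV0 q₁ b₁)
    (hP : IsGeometricPartition q₀ q₁ b₀ b₁ Λ t) :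
    ∃ D : ℝ≥0∞, D < ∞ ∧ ∀ f : V, (∀ k, KFun N₀ N₁ (t k) f < ∞) → ∀ k,
      KFun (interpNorm N₀ N₁ 0 q₀ b₀) (interpNorm N₀ N₁ 0 q₁ b₁) (rho q₀ q₁ b₀ b₁ (t k)) f ≤
        D * ((∑' i : ℕ, (ENNReal.ofReal (tailNorm q₀ b₀ (t (k - i))) *
            KFun N₀ N₁ (t (k - i)) f) ^ q₀) ^ (1 / q₀) +
          ENNReal.ofReal (rho q₀ q₁ b₀ b₁ (t k)) *
            (∑' i : ℕ, (ENNReal.ofReal (tailNorm q₁ b₁ (t (k + i))) *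
              KFun N₀ N₁ (t (k + i)) f) ^ q₁) ^ (1 / q₁)) := by
  obtain ⟨C, hC⟩ := exists_decomposition_KFun_le (N₀ := N₀) (N₁ := N₁) h₀ h₁
  obtain ⟨C₁, hC₁⟩ := exists_lintegral_density_mul_le hq₁ hb₁
  have hΛ0 : 0 ≤ Λ := zero_le_one.trans hP.one_lt.le
  set D₀ : ℝ≥0∞ := C ^ q₀ * (ENNReal.ofReal Λ ^ q₀ + 1) with hD₀
  set D₁ : ℝ≥0∞ := C ^ q₁ * (C₁ + ENNReal.ofReal Λ ^ q₁) with hD₁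
  have hD₀t : D₀ ≠ ∞ := by
    have := hq₀.le
    finiteness
  have hD₁t : D₁ ≠ ∞ := by
    have := hq₁.le
    finiteness
  refine ⟨D₀ ^ (1 / q₀) + D₁ ^ (1 / q₁), ?_, fun f hf k => ?_⟩
  · have : 0 ≤ 1 / q₀ := by positivity
    have : 0 ≤ 1 / q₁ := by positivity
    finiteness
  have hfin : ∀ k, KFun N₀ N₁ (t k) f ≠ ∞ := fun k => (hf k).ne
  obtain ⟨f₀, f₁, hsum, hf₀s, hf₀l, hf₁s, hf₁l⟩ := hC (t k) (hP.pos k) f (hf k)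
  set S₀ : ℝ≥0∞ := ∑' i : ℕ, (ENNReal.ofReal (tailNorm q₀ b₀ (t (k - i))) *
            KFun N₀ N₁ (t (k - i)) f) ^ q₀ with hS₀
  set S₁ : ℝ≥0∞ := ∑' i : ℕ, (ENNReal.ofReal (tailNorm q₁ b₁ (t (k + i))) *
              KFun N₀ N₁ (t (k + i)) f) ^ q₁ with hS₁
  have hX₀ : interpNorm N₀ N₁ 0 q₀ b₀ f₀ ≤ D₀ ^ (1 / q₀) * S₀ ^ (1 / q₀) := by
    rw [← ENNReal.mul_rpow_of_nonneg _ _ (by positivity), one_div, ENNReal.le_rpow_inv_iff hq₀,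
      interpNorm_zero_rpow hq₀ (fun _ => hb₀.pos), lintegral_Ioi_zero_eq_add (hP.pos k).le, hD₀,
      mul_assoc, add_mul, mul_add]
    gcongr ?_ + ?_
    · calc _ ≤ ∫⁻ u in Ioc 0 (t k), C ^ q₀ *
            (ENNReal.ofReal (b₀ u ^ q₀ / u) * KFun N₀ N₁ u f ^ q₀) := by
            refine setLIntegral_mono_ae' measurableSet_Ioc (ae_of_all _ fun u hu => ?_)
            rw [mul_left_comm, ← ENNReal.mul_rpow_of_nonneg _ _ hq₀.le]
            gcongr
            exact hf₀s u hu.1 hu.2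
        _ ≤ _ := by
            rw [lintegral_const_mul' _ _ (by have := hq₀.le; finiteness)]
            gcongr
            refine (lintegral_density_mul_Ioc_zero_le hq₀ hb₀ hP.mono hP.pos hP.cover hΛ0
              (hP.tailNorm_left hq₀ hq₁ hb₀ hb₁) (KFun_mono f) hfin k).trans_eq ?_
            rw [hS₀, ← ENNReal.tsum_mul_left]
            exact tsum_congr fun i => ENNReal.mul_rpow_of_nonneg _ _ hq₀.le
    · calc _ ≤ ∫⁻ u in Ioi (t k), ENNReal.ofReal (b₀ u ^ q₀ / u) *
            (C * KFun N₀ N₁ (t k) f) ^ q₀ := by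
            refine setLIntegral_mono_ae' measurableSet_Ioi (ae_of_all _ fun u hu => ?_)
            gcongr
            exact hf₀l u
        _ = C ^ q₀ * (ENNReal.ofReal (tailNorm q₀ b₀ (t k)) * KFun N₀ N₁ (t k) f) ^ q₀ := by
            rw [lintegral_mul_const' _ _ (by have := hq₀.le; have := hfin k; finiteness),
              lintegral_density_Ioi hq₀ hb₀ (hP.pos k), ← ofReal_tailNorm_rpow hq₀ hb₀ (hP.pos k),
              ENNReal.mul_rpow_of_nonneg _ _ hq₀.le, ENNReal.mul_rpow_of_nonneg _ _ hq₀.le]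
            ring
        _ ≤ _ := by
            rw [one_mul]
            gcongr
            simpa using ENNReal.le_tsum (f := fun i : ℕ =>
              (ENNReal.ofReal (tailNorm q₀ b₀ (t (k - i))) * KFun N₀ N₁ (t (k - i)) f) ^ q₀) 0
  have hX₁ : interpNorm N₀ N₁ 0 q₁ b₁ f₁ ≤ D₁ ^ (1 / q₁) * S₁ ^ (1 / q₁) := by
    rw [← ENNReal.mul_rpow_of_nonneg _ _ (by positivity), one_div, ENNReal.le_rpow_inv_iff hq₁,
      interpNorm_zero_rpow hq₁ (fun _ => hb₁.pos), lintegral_Ioi_zero_eq_add (hP.pos k).le, hD₁,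
      mul_assoc, add_mul, mul_add]
    gcongr ?_ + ?_
    -- Near `0` the linear bound on `K(·,f₁)` compensates for the infinite mass of the density of
    -- `b₁`.
    · calc _ ≤ ∫⁻ u in Ioc 0 (t k), (ENNReal.ofReal (b₁ u ^ q₁ / u) *
            ENNReal.ofReal (u / t k) ^ q₁) * (C * KFun N₀ N₁ (t k) f) ^ q₁ := by
            refine setLIntegral_mono_ae' measurableSet_Ioc (ae_of_all _ fun u hu => ?_)
            rw [mul_assoc, ← ENNReal.mul_rpow_of_nonneg _ _ hq₁.le]
            gcongr
            exact hf₁s u hu.1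
        _ ≤ (C₁ * ENNReal.ofReal (tail q₁ b₁ (t k))) * (C * KFun N₀ N₁ (t k) f) ^ q₁ := by
            rw [lintegral_mul_const' _ _ (by have := hq₁.le; have := hfin k; finiteness)]
            gcongr
            exact hC₁ (t k) (hP.pos k)
        _ = C ^ q₁ *
            (C₁ * (ENNReal.ofReal (tailNorm q₁ b₁ (t k)) * KFun N₀ N₁ (t k) f) ^ q₁) := by
            rw [← ofReal_tailNorm_rpow hq₁ hb₁ (hP.pos k),
              ENNReal.mul_rpow_of_nonneg _ _ hq₁.le, ENNReal.mul_rpow_of_nonneg _ _ hq₁.le]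
            ring
        _ ≤ _ := by
            gcongr
            simpa using ENNReal.le_tsum (f := fun i : ℕ =>
              (ENNReal.ofReal (tailNorm q₁ b₁ (t (k + i))) * KFun N₀ N₁ (t (k + i)) f) ^ q₁) 0
    · calc _ ≤ ∫⁻ u in Ioi (t k), C ^ q₁ *
            (ENNReal.ofReal (b₁ u ^ q₁ / u) * KFun N₀ N₁ u f ^ q₁) := by
            refine setLIntegral_mono_ae' measurableSet_Ioi (ae_of_all _ fun u hu => ?_)
            rw [mul_left_comm, ← ENNReal.mul_rpow_of_nonneg _ _ hq₁.le]
            gcongr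
            exact hf₁l u (le_of_lt hu)
        _ ≤ _ := by
            rw [lintegral_const_mul' _ _ (by have := hq₁.le; finiteness)]
            gcongr
            refine (lintegral_density_mul_Ioi_le hq₁ hb₁ hP.mono hP.pos hP.cover hΛ0
              (fun k => (hP.tailNorm_right hq₁ hb₁ k).ge) (KFun_mono f) hfin k).trans_eq ?_
            rw [hS₁, ← ENNReal.tsum_mul_left]
            exact tsum_congr fun i => ENNReal.mul_rpow_of_nonneg _ _ hq₁.le
  calc _ ≤ interpNorm N₀ N₁ 0 q₀ b₀ f₀ +
        ENNReal.ofReal (rho q₀ q₁ b₀ b₁ (t k)) * interpNorm N₀ N₁ 0 q₁ b₁ f₁ := KFun_le hsum _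
    _ ≤ (D₀ ^ (1 / q₀) + D₁ ^ (1 / q₁)) * S₀ ^ (1 / q₀) +
        ENNReal.ofReal (rho q₀ q₁ b₀ b₁ (t k)) *
          ((D₀ ^ (1 / q₀) + D₁ ^ (1 / q₁)) * S₁ ^ (1 / q₁)) := by
        gcongr
        · exact hX₀.trans (by gcongr; exact le_self_add)
        · exact hX₁.trans (by gcongr; exact le_add_self)
    _ = _ := by ring

end Upper

/-! ### Discretization of the two quasi-norms. -/

section

/-- The absolute value covers exponents of either sign; it serves `q / q₁ - 1`. -/
theorem rpow_le_rpow_abs_mul {x y L γ : ℝ} (hx : 0 < x) (hy : 0 < y) (hL : 1 ≤ L) (hxy : x ≤ L * y)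
    (hyx : y ≤ L * x) : x ^ γ ≤ L ^ |γ| * y ^ γ := by
  have hL0 : 0 < L := one_pos.trans_le hL
  rcases le_total 0 γ with hγ | hγ
  · rw [abs_of_nonneg hγ, ← Real.mul_rpow hL0.le hy.le]
    exact Real.rpow_le_rpow hx.le hxy hγ
  · rw [abs_of_nonpos hγ, Real.rpow_neg hL0.le, ← Real.inv_rpow hL0.le,
      ← Real.mul_rpow (by positivity) hy.le]
    refine Real.rpow_le_rpow_of_nonpos (by positivity) ?_ hγ
    rwa [inv_mul_le_iff₀ hL0]

/-- The value of the weight `s ^ (-θ) * b s` at `s = ρ(t)`. -/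
noncomputable def rhoWeight (θ q₀ q₁ : ℝ) (b b₀ b₁ : ℝ → ℝ) (t : ℝ) : ℝ :=
  rho q₀ q₁ b₀ b₁ t ^ (-θ) * b (rho q₀ q₁ b₀ b₁ t)

variable {q₀ q₁ q θ : ℝ} {b b₀ b₁ : ℝ → ℝ} {Λ : ℝ} {t : ℤ → ℝ}

theorem rhoWeight_pos (hq₀ : 0 < q₀) (hq₁ : 0 < q₁) (hb : IsSlowlyVarying b) (hb₀ : IsSV0 q₀ b₀)
    (hb₁ : IsSV0 q₁ b₁) {t : ℝ} (ht : 0 < t) : 0 < rhoWeight θ q₀ q₁ b b₀ b₁ t :=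
  mul_pos (Real.rpow_pos_of_pos (rho_pos hq₀ hq₁ hb₀ hb₁ ht) _)
    (hb.pos _ (rho_pos hq₀ hq₁ hb₀ hb₁ ht))

theorem btilde_pos (hq₀ : 0 < q₀) (hq₁ : 0 < q₁) (hb : IsSlowlyVarying b) (hb₀ : IsSV0 q₀ b₀)
    (hb₁ : IsSV0 q₁ b₁) {t : ℝ} (ht : 0 < t) : 0 < btilde θ q q₀ q₁ b b₀ b₁ t := by
  have hr := rho_pos hq₀ hq₁ hb₀ hb₁ ht
  have := hb.pos _ hr
  have := hb₁.pos ht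
  have := tail_pos hq₁ hb₁ ht
  rw [btilde]
  positivity

theorem btilde_rpow (hq₀ : 0 < q₀) (hq₁ : 0 < q₁) (hq : 0 < q) (hb : IsSlowlyVarying b)
    (hb₀ : IsSV0 q₀ b₀) (hb₁ : IsSV0 q₁ b₁) (hθ₁ : θ < 1) {t : ℝ} (ht : 0 < t) :
    btilde θ q q₀ q₁ b b₀ b₁ t ^ q =
      (rho q₀ q₁ b₀ b₁ t * rhoWeight θ q₀ q₁ b b₀ b₁ t) ^ q * b₁ t ^ q₁ *
        tail q₁ b₁ t ^ (q / q₁ - 1) := by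
  have hr := rho_pos hq₀ hq₁ hb₀ hb₁ ht
  have := hb.pos _ hr
  have hb1 := hb₁.pos ht
  have hT := tail_pos hq₁ hb₁ ht
  rw [btilde, rhoWeight, ← mul_assoc (rho q₀ q₁ b₀ b₁ t),
    ← Real.rpow_one_add' hr.le (by linarith), ← sub_eq_add_neg,
    Real.mul_rpow (by positivity) (by positivity), Real.mul_rpow (by positivity) (by positivity),
    ← Real.rpow_mul hb1.le, ← Real.rpow_mul hT.le]
  congr 2
  · field_simp
  · field_simp

/-- With `R = ρ · rhoWeight` and `T₁` the tail of `b₁`, the density of `b̃^q` is `R^q T₁^(q/q₁-1)`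
times that of `b₁^q₁`. On a block `R` is almost increasing and `T₁` changes by the fixed factor `L`.
The integral of the last density is the drop of `T₁`, a fixed proportion of `T₁`, so the block has
mass of order `R^q T₁^(q/q₁) = (R N₁)^q`, taken at its right end from above and its left end from
below; finally `ρ N₁ = N₀`. -/
theorem IsGeometricPartition.exists_btilde_bounds (hP : IsGeometricPartition q₀ q₁ b₀ b₁ Λ t)
    (hρ_mono : MonotoneOn (rho q₀ q₁ b₀ b₁) (Ioi 0)) (hq₀ : 0 < q₀) (hq₁ : 0 < q₁) (hq : 0 < q)
    (hb : IsSlowlyVarying b) (hb₀ : IsSV0 q₀ b₀) (hb₁ : IsSV0 q₁ b₁) (hθ₀ : 0 < θ) (hθ₁ : θ < 1) :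
    ∃ C : ℝ, 0 < C ∧ ∀ k,
      ∫⁻ u in Ioc (t k) (t (k + 1)), ENNReal.ofReal (btilde θ q q₀ q₁ b b₀ b₁ u ^ q / u) ≤
        ENNReal.ofReal (C * (rhoWeight θ q₀ q₁ b b₀ b₁ (t (k + 1)) *
          tailNorm q₀ b₀ (t (k + 1))) ^ q) ∧
      ENNReal.ofReal ((rhoWeight θ q₀ q₁ b b₀ b₁ (t k) * tailNorm q₀ b₀ (t k)) ^ q) ≤
        ENNReal.ofReal C *
          ∫⁻ u in Ioc (t k) (t (k + 1)), ENNReal.ofReal (btilde θ q q₀ q₁ b b₀ b₁ u ^ q / u) := by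
  obtain ⟨M, hM, hMw⟩ := hb.exists_weight_le hθ₀ hθ₁
  have hΛ0 : 0 < Λ := one_pos.trans hP.one_lt
  set L : ℝ := Λ ^ q₁ with hL
  have hL1 : 1 < L := Real.one_lt_rpow hP.one_lt hq₁
  have hL0 : 0 < L := one_pos.trans hL1
  set γ : ℝ := q / q₁ - 1 with hγ
  set R : ℝ → ℝ := fun u => rho q₀ q₁ b₀ b₁ u * rhoWeight θ q₀ q₁ b b₀ b₁ u with hR
  have hRpos : ∀ u, 0 < u → 0 < R u := fun u hu =>
    mul_pos (rho_pos hq₀ hq₁ hb₀ hb₁ hu) (rhoWeight_pos hq₀ hq₁ hb hb₀ hb₁ hu)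
  have hRle : ∀ s u, 0 < s → s ≤ u → R s ≤ M * R u := by
    intro s u hs hsu
    have hu := hs.trans_le hsu
    have hrs := rho_pos hq₀ hq₁ hb₀ hb₁ hs
    have hru := rho_pos hq₀ hq₁ hb₀ hb₁ hu
    have hle := hρ_mono hs hu hsu
    refine (hMw _ _ hrs hle).2.trans ?_
    have h1 : (rho q₀ q₁ b₀ b₁ s / rho q₀ q₁ b₀ b₁ u) ^ ((1 - θ) / 2) ≤ 1 :=
      Real.rpow_le_one (by positivity) ((div_le_one hru).2 hle) (by linarith)
    have := hRpos u hu
    calc _ ≤ M * 1 * R u := by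
          gcongr ?_ * ?_
          · gcongr
          · exact le_rfl
      _ = _ := by rw [mul_one]
  have hT := fun k => tail_pos hq₁ hb₁ (hP.pos k)
  have hform : ∀ k, R (t k) ^ q * (tail q₁ b₁ (t k) ^ γ * tail q₁ b₁ (t k)) =
      (rhoWeight θ q₀ q₁ b b₀ b₁ (t k) * tailNorm q₀ b₀ (t k)) ^ q := by
    intro k
    have hw := rhoWeight_pos (θ := θ) hq₀ hq₁ hb hb₀ hb₁ (hP.pos k)
    have hr := rho_pos hq₀ hq₁ hb₀ hb₁ (hP.pos k)
    have hn := tailNorm_pos hq₁ hb₁ (hP.pos k)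
    have e : tail q₁ b₁ (t k) ^ γ * tail q₁ b₁ (t k) = tailNorm q₁ b₁ (t k) ^ q := by
      rw [tailNorm, ← Real.rpow_mul (hT k).le, ← Real.rpow_add_one (hT k).ne', hγ]
      congr 1
      field_simp
      ring
    rw [e, ← Real.mul_rpow (hRpos _ (hP.pos k)).le hn.le,
      ← rho_mul_tailNorm (q₀ := q₀) (b₀ := b₀) hq₁ hb₁ (hP.pos k)]
    simp only [hR]
    ring_nf
  have hMq := Real.rpow_pos_of_pos hM q
  have hLγ := Real.rpow_pos_of_pos hL0 |γ|
  have hpw : ∀ k, ∀ u ∈ Ioc (t k) (t (k + 1)),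
      btilde θ q q₀ q₁ b b₀ b₁ u ^ q / u ≤
        M ^ q * R (t (k + 1)) ^ q * (L ^ |γ| * tail q₁ b₁ (t (k + 1)) ^ γ) * (b₁ u ^ q₁ / u) ∧
      R (t k) ^ q * tail q₁ b₁ (t k) ^ γ * (b₁ u ^ q₁ / u) ≤
        M ^ q * L ^ |γ| * (btilde θ q q₀ q₁ b b₀ b₁ u ^ q / u) := by
    intro k u hu
    have hu0 : 0 < u := (hP.pos k).trans hu.1
    have hTu := tail_pos hq₁ hb₁ hu0
    have hd := hb₁.density_pos hu0
    have hanti := (tail_strictAntiOn hq₁ hb₁).antitoneOn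
    have h1 : tail q₁ b₁ u ≤ tail q₁ b₁ (t k) := hanti (hP.pos k) hu0 hu.1.le
    have h2 : tail q₁ b₁ (t (k + 1)) ≤ tail q₁ b₁ u := hanti hu0 (hP.pos _) hu.2
    have h3 : L * tail q₁ b₁ (t (k + 1)) = tail q₁ b₁ (t k) := hP.tail_succ k
    have hk := hT k
    have hk' := hT (k + 1)
    have hRu := hRpos u hu0
    have hRk := hRpos _ (hP.pos k)
    have hRk' := hRpos _ (hP.pos (k + 1))
    rw [btilde_rpow hq₀ hq₁ hq hb hb₀ hb₁ hθ₁ hu0, ← hγ]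
    have e : R u ^ q * b₁ u ^ q₁ * tail q₁ b₁ u ^ γ / u =
      R u ^ q * tail q₁ b₁ u ^ γ * (b₁ u ^ q₁ / u) := by ring
    change R u ^ q * b₁ u ^ q₁ * tail q₁ b₁ u ^ γ / u ≤ _ ∧
      _ ≤ M ^ q * L ^ |γ| * (R u ^ q * b₁ u ^ q₁ * tail q₁ b₁ u ^ γ / u)
    rw [e]
    constructor
    · gcongr
      · rw [← Real.mul_rpow hM.le hRk'.le]
        exact Real.rpow_le_rpow hRu.le (hRle _ _ hu0 hu.2) hq.le
      · exact rpow_le_rpow_abs_mul hTu hk' hL1.le (h1.trans h3.ge)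
          (h2.trans (le_mul_of_one_le_left hTu.le hL1.le))
    · have h4 : R (t k) ^ q ≤ M ^ q * R u ^ q := by
        rw [← Real.mul_rpow hM.le hRu.le]
        exact Real.rpow_le_rpow hRk.le (hRle _ _ (hP.pos k) hu.1.le) hq.le
      have h5 : tail q₁ b₁ (t k) ^ γ ≤ L ^ |γ| * tail q₁ b₁ u ^ γ := by
        refine rpow_le_rpow_abs_mul hk hTu hL1.le ?_ ?_
        · rw [← h3]
          gcongr
        · exact h1.trans (le_mul_of_one_le_left hk.le hL1.le)
      calc _ ≤ (M ^ q * R u ^ q) * (L ^ |γ| * tail q₁ b₁ u ^ γ) * (b₁ u ^ q₁ / u) := by gcongr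
        _ = _ := by ring
  have hdens : ∀ k, ∫⁻ u in Ioc (t k) (t (k + 1)), ENNReal.ofReal (b₁ u ^ q₁ / u) =
      ENNReal.ofReal (tail q₁ b₁ (t k) - tail q₁ b₁ (t (k + 1))) := fun k =>
    lintegral_density_Ioc hq₁ hb₁ (hP.pos k) (hP.mono (by omega))
  set C₁ : ℝ := M ^ q * L ^ |γ| * L with hC₁
  -- The factor `1 - L⁻¹` is the proportion of the tail lost across one block.
  set C₂ : ℝ := M ^ q * L ^ |γ| / (1 - L⁻¹) with hC₂
  have hLinv : 0 < 1 - L⁻¹ := sub_pos.2 (inv_lt_one_of_one_lt₀ hL1)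
  have hC₁0 : 0 < C₁ := by positivity
  have hC₂0 : 0 < C₂ := by positivity
  refine ⟨max C₁ C₂, lt_max_of_lt_left hC₁0, fun k => ?_⟩
  have hk := hT k
  have hk' := hT (k + 1)
  have hRk := hRpos _ (hP.pos k)
  have hRk' := hRpos _ (hP.pos (k + 1))
  have h3 : L * tail q₁ b₁ (t (k + 1)) = tail q₁ b₁ (t k) := hP.tail_succ k
  constructor
  · set a : ℝ := M ^ q * R (t (k + 1)) ^ q * (L ^ |γ| * tail q₁ b₁ (t (k + 1)) ^ γ) with ha
    have ha0 : 0 ≤ a := by positivity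
    calc _ ≤ ∫⁻ u in Ioc (t k) (t (k + 1)), ENNReal.ofReal a * ENNReal.ofReal (b₁ u ^ q₁ / u) := by
          refine setLIntegral_mono_ae' measurableSet_Ioc (ae_of_all _ fun u hu => ?_)
          rw [← ENNReal.ofReal_mul ha0]
          exact ENNReal.ofReal_le_ofReal (hpw k u hu).1
      _ = ENNReal.ofReal (a * (tail q₁ b₁ (t k) - tail q₁ b₁ (t (k + 1)))) := by
          rw [lintegral_const_mul' _ _ ENNReal.ofReal_ne_top, hdens, ENNReal.ofReal_mul ha0]
      _ ≤ _ := by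
          refine ENNReal.ofReal_le_ofReal ?_
          rw [← hform, ← h3]
          calc a * (L * tail q₁ b₁ (t (k + 1)) - tail q₁ b₁ (t (k + 1)))
              ≤ a * (L * tail q₁ b₁ (t (k + 1))) := by
                gcongr
                linarith
            _ = C₁ * (R (t (k + 1)) ^ q *
                  (tail q₁ b₁ (t (k + 1)) ^ γ * tail q₁ b₁ (t (k + 1)))) := by
                rw [ha, hC₁]
                ring
            _ ≤ _ := by
                gcongr
                exact le_max_left _ _
  · set a : ℝ := R (t k) ^ q * tail q₁ b₁ (t k) ^ γ with ha
    have ha0 : 0 ≤ a := by positivity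
    have hlow : ENNReal.ofReal (a * (tail q₁ b₁ (t k) - tail q₁ b₁ (t (k + 1)))) ≤
        ENNReal.ofReal (M ^ q * L ^ |γ|) *
          ∫⁻ u in Ioc (t k) (t (k + 1)), ENNReal.ofReal (btilde θ q q₀ q₁ b b₀ b₁ u ^ q / u) := by
      rw [ENNReal.ofReal_mul ha0, ← hdens, ← lintegral_const_mul' _ _ ENNReal.ofReal_ne_top,
        ← lintegral_const_mul' _ _ ENNReal.ofReal_ne_top]
      refine setLIntegral_mono_ae' measurableSet_Ioc (ae_of_all _ fun u hu => ?_)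
      rw [← ENNReal.ofReal_mul ha0, ← ENNReal.ofReal_mul (by positivity)]
      exact ENNReal.ofReal_le_ofReal (hpw k u hu).2
    have e : (rhoWeight θ q₀ q₁ b b₀ b₁ (t k) * tailNorm q₀ b₀ (t k)) ^ q =
        (1 - L⁻¹)⁻¹ * (a * (tail q₁ b₁ (t k) - tail q₁ b₁ (t (k + 1)))) := by
      rw [← hform, ha, ← h3]
      have : L - 1 ≠ 0 := by linarith
      field_simp
    rw [e, ENNReal.ofReal_mul (by positivity)]
    calc _ ≤ ENNReal.ofReal (1 - L⁻¹)⁻¹ * (ENNReal.ofReal (M ^ q * L ^ |γ|) *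
          ∫⁻ u in Ioc (t k) (t (k + 1)), ENNReal.ofReal (btilde θ q q₀ q₁ b b₀ b₁ u ^ q / u)) := by
          gcongr
      _ = ENNReal.ofReal C₂ *
          ∫⁻ u in Ioc (t k) (t (k + 1)), ENNReal.ofReal (btilde θ q q₀ q₁ b b₀ b₁ u ^ q / u) := by
          rw [← mul_assoc, ← ENNReal.ofReal_mul (by positivity), hC₂]
          congr 2
          ring
      _ ≤ _ := by
          gcongr
          exact le_max_right _ _

/-- A block between consecutive values of `ρ` has length at least its left endpoint, by doubling,
and endpoints of ratio at most `Λ`. -/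
theorem IsGeometricPartition.exists_weight_bounds (hP : IsGeometricPartition q₀ q₁ b₀ b₁ Λ t)
    (hq₀ : 0 < q₀) (hq₁ : 0 < q₁) (hq : 0 < q)
    (hb : IsSlowlyVarying b) (hb₀ : IsSV0 q₀ b₀) (hb₁ : IsSV0 q₁ b₁) (hθ₀ : 0 < θ) (hθ₁ : θ < 1) :
    ∃ C : ℝ, 0 < C ∧ ∀ k,
      ∫⁻ u in Ioc (rho q₀ q₁ b₀ b₁ (t k)) (rho q₀ q₁ b₀ b₁ (t (k + 1))),
          ENNReal.ofReal ((u ^ (-θ) * b u) ^ q / u) ≤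
        ENNReal.ofReal (C * rhoWeight θ q₀ q₁ b b₀ b₁ (t (k + 1)) ^ q) ∧
      ENNReal.ofReal (rhoWeight θ q₀ q₁ b b₀ b₁ (t k) ^ q) ≤
        ENNReal.ofReal C *
          ∫⁻ u in Ioc (rho q₀ q₁ b₀ b₁ (t k)) (rho q₀ q₁ b₀ b₁ (t (k + 1))),
            ENNReal.ofReal ((u ^ (-θ) * b u) ^ q / u) := by
  obtain ⟨M, hM, hMw⟩ := hb.exists_weight_le hθ₀ hθ₁
  have hΛ0 : 0 < Λ := one_pos.trans hP.one_lt
  -- Since `s · s^(-θ) b(s)` is almost increasing, the weight itself falls by at most a constant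
  -- factor over a ratio of `Λ`.
  have hle : ∀ s u, 0 < s → s ≤ u → u ≤ Λ * s →
      s ^ (-θ) * b s ≤ M * Λ * (u ^ (-θ) * b u) := by
    intro s u hs hsu hus
    have hu := hs.trans_le hsu
    have hbu := hb.pos u hu
    have h1 : (s / u) ^ ((1 - θ) / 2) ≤ 1 :=
      Real.rpow_le_one (by positivity) ((div_le_one hu).2 hsu) (by linarith)
    have h2 : s * (s ^ (-θ) * b s) ≤ s * (M * Λ * (u ^ (-θ) * b u)) := by
      calc _ ≤ M * (s / u) ^ ((1 - θ) / 2) * (u * (u ^ (-θ) * b u)) := (hMw s u hs hsu).2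
        _ ≤ M * 1 * ((Λ * s) * (u ^ (-θ) * b u)) := by gcongr
        _ = _ := by ring
    exact le_of_mul_le_mul_left h2 hs
  refine ⟨(M * Λ) ^ q * Λ, by positivity, fun k => ?_⟩
  set r : ℝ := rho q₀ q₁ b₀ b₁ (t k) with hr
  set r' : ℝ := rho q₀ q₁ b₀ b₁ (t (k + 1)) with hr'
  have hr0 : 0 < r := rho_pos hq₀ hq₁ hb₀ hb₁ (hP.pos k)
  have hr'0 : 0 < r' := rho_pos hq₀ hq₁ hb₀ hb₁ (hP.pos (k + 1))
  have h2r : 2 * r ≤ r' := hP.two_mul_rho_le k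
  have hrΛ : r' ≤ Λ * r := hP.rho_succ_le k
  have hbr := hb.pos r hr0
  have hbr' := hb.pos r' hr'0
  rw [rhoWeight, rhoWeight, ← hr, ← hr']
  constructor
  · set a : ℝ := (M * Λ * (r' ^ (-θ) * b r')) ^ q / r with ha
    have ha0 : 0 ≤ a := by positivity
    calc _ ≤ ∫⁻ u in Ioc r r', ENNReal.ofReal a := by
          refine setLIntegral_mono_ae' measurableSet_Ioc (ae_of_all _ fun u hu => ?_)
          have hu0 : 0 < u := hr0.trans hu.1
          have hbu := hb.pos u hu0
          refine ENNReal.ofReal_le_ofReal (div_le_div₀ (by positivity) ?_ hr0 hu.1.le)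
          refine Real.rpow_le_rpow (by positivity) (hle u r' hu0 hu.2 (hrΛ.trans ?_)) hq.le
          gcongr
          exact hu.1.le
      _ = ENNReal.ofReal (a * (r' - r)) := by
          rw [setLIntegral_const, Real.volume_Ioc, ENNReal.ofReal_mul ha0]
      _ ≤ _ := by
          refine ENNReal.ofReal_le_ofReal ?_
          calc a * (r' - r) ≤ a * (Λ * r) := by
                gcongr
                linarith
            _ = _ := by
                rw [ha, Real.mul_rpow (by positivity) (by positivity)]
                field_simp
  · set a : ℝ := (r ^ (-θ) * b r) ^ q / r with ha
    have ha0 : 0 ≤ a := by positivity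
    rw [← lintegral_const_mul' _ _ ENNReal.ofReal_ne_top]
    calc ENNReal.ofReal ((r ^ (-θ) * b r) ^ q) ≤ ENNReal.ofReal (a * (r' - r)) := by
          refine ENNReal.ofReal_le_ofReal ?_
          calc (r ^ (-θ) * b r) ^ q = a * r := by
                rw [ha]
                field_simp
            _ ≤ _ := by
                gcongr
                linarith
      _ = ∫⁻ u in Ioc r r', ENNReal.ofReal a := by
          rw [setLIntegral_const, Real.volume_Ioc, ENNReal.ofReal_mul ha0]
      _ ≤ _ := by
          refine setLIntegral_mono_ae' measurableSet_Ioc (ae_of_all _ fun u hu => ?_)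
          have hu0 : 0 < u := hr0.trans hu.1
          have hbu := hb.pos u hu0
          rw [← ENNReal.ofReal_mul (by positivity)]
          refine ENNReal.ofReal_le_ofReal ?_
          have h1 : (r ^ (-θ) * b r) ^ q ≤ (M * Λ) ^ q * (u ^ (-θ) * b u) ^ q := by
            rw [← Real.mul_rpow (by positivity) (by positivity)]
            exact Real.rpow_le_rpow (by positivity)
              (hle r u hr0 hu.1.le (hu.2.trans hrΛ)) hq.le
          calc a ≤ ((M * Λ) ^ q * (u ^ (-θ) * b u) ^ q) / (u / Λ) := by
                refine div_le_div₀ (by positivity) h1 (by positivity) ?_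
                rw [div_le_iff₀ hΛ0, mul_comm]
                exact hu.2.trans hrΛ
            _ = _ := by field_simp

end

theorem add_rpow_le_two_rpow_mul {q : ℝ} (hq : 0 ≤ q) (x y : ℝ≥0∞) :
    (x + y) ^ q ≤ 2 ^ q * (x ^ q + y ^ q) := by
  calc (x + y) ^ q ≤ (2 * max x y) ^ q := by
        rw [two_mul]
        gcongr
        · exact le_max_left _ _
        · exact le_max_right _ _
    _ = 2 ^ q * max x y ^ q := ENNReal.mul_rpow_of_nonneg _ _ hq
    _ ≤ _ := by
        gcongr
        rcases le_total x y with h | h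
        · rw [max_eq_right h]
          exact le_add_self
        · rw [max_eq_left h]
          exact le_self_add

/-! ### Hardy's inequality and the equivalence of the quasi-norms. -/

section Reiteration

variable {V : Type*} [AddCommGroup V] {N₀ N₁ : V → ℝ≥0∞} {𝕜 : Type*} [RCLike 𝕜] [Module 𝕜 V]
  [TopologicalSpace V] {q₀ q₁ q θ : ℝ} {b b₀ b₁ : ℝ → ℝ} {Λ : ℝ} {t : ℤ → ℝ}

/-- The power decay of the weight along the doubling sequence `ρ(t_k)` becomes geometric decay in
the index; these are the two hypotheses of the discrete Hardy inequality, for shifts to the left and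
to the right. -/
theorem IsGeometricPartition.rhoWeight_le (hP : IsGeometricPartition q₀ q₁ b₀ b₁ Λ t)
    (hq₀ : 0 < q₀) (hq₁ : 0 < q₁) (hb : IsSlowlyVarying b) (hb₀ : IsSV0 q₀ b₀) (hb₁ : IsSV0 q₁ b₁)
    (hθ₀ : 0 < θ) (hθ₁ : θ < 1) :
    ∃ M : ℝ, ∀ (i : ℕ) (k : ℤ),
      ENNReal.ofReal (rhoWeight θ q₀ q₁ b b₀ b₁ (t k)) ≤ ENNReal.ofReal M *
        ENNReal.ofReal ((1 / 2) ^ (θ / 2)) ^ i *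
          ENNReal.ofReal (rhoWeight θ q₀ q₁ b b₀ b₁ (t (k - i))) ∧
      ENNReal.ofReal (rho q₀ q₁ b₀ b₁ (t k)) * ENNReal.ofReal (rhoWeight θ q₀ q₁ b b₀ b₁ (t k)) ≤
        ENNReal.ofReal M * ENNReal.ofReal ((1 / 2) ^ ((1 - θ) / 2)) ^ i *
          (ENNReal.ofReal (rho q₀ q₁ b₀ b₁ (t (k + i))) *
            ENNReal.ofReal (rhoWeight θ q₀ q₁ b b₀ b₁ (t (k + i)))) := by
  obtain ⟨M, hM, hMw⟩ := hb.exists_weight_le hθ₀ hθ₁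
  have hr : ∀ k, 0 < rho q₀ q₁ b₀ b₁ (t k) := fun k => rho_pos hq₀ hq₁ hb₀ hb₁ (hP.pos k)
  have hw : ∀ k, 0 < rhoWeight θ q₀ q₁ b b₀ b₁ (t k) := fun k =>
    rhoWeight_pos hq₀ hq₁ hb hb₀ hb₁ (hP.pos k)
  have hle : ∀ (i : ℕ) (k : ℤ), rho q₀ q₁ b₀ b₁ (t (k - i)) ≤ rho q₀ q₁ b₀ b₁ (t k) := fun i k =>
    (rho_sub_natCast_le hP i k).trans
      (mul_le_of_le_one_left (hr k).le (pow_le_one₀ (by norm_num) (by norm_num)))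
  have hgeo : ∀ (i : ℕ) (k : ℤ) (α : ℝ), 0 ≤ α →
      (rho q₀ q₁ b₀ b₁ (t (k - i)) / rho q₀ q₁ b₀ b₁ (t k)) ^ α ≤ ((1 / 2) ^ α) ^ i := by
    intro i k α hα
    rw [← Real.rpow_natCast, ← Real.rpow_mul (by norm_num), mul_comm, Real.rpow_mul (by norm_num),
      Real.rpow_natCast]
    refine Real.rpow_le_rpow (div_nonneg (hr _).le (hr _).le) ?_ hα
    rw [div_le_iff₀ (hr k)]
    exact rho_sub_natCast_le hP i k
  refine ⟨M, fun i k => ⟨?_, ?_⟩⟩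
  · rw [← ENNReal.ofReal_pow (by positivity), ← ENNReal.ofReal_mul hM.le,
      ← ENNReal.ofReal_mul (by positivity)]
    refine ENNReal.ofReal_le_ofReal ((hMw _ _ (hr _) (hle i k)).1.trans ?_)
    have := (hw (k - i)).le
    change M * _ * rhoWeight θ q₀ q₁ b b₀ b₁ (t (k - i)) ≤ _
    gcongr
    exact hgeo i k _ (by positivity)
  · rw [← ENNReal.ofReal_pow (by positivity), ← ENNReal.ofReal_mul hM.le,
      ← ENNReal.ofReal_mul (hr _).le, ← ENNReal.ofReal_mul (hr _).le,
      ← ENNReal.ofReal_mul (by positivity)]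
    have h1 := hle i (k + i)
    have h2 := hgeo i (k + i) ((1 - θ) / 2) (by linarith)
    rw [add_sub_cancel_right] at h1 h2
    refine ENNReal.ofReal_le_ofReal ((hMw _ _ (hr _) h1).2.trans ?_)
    have := (hw (k + i)).le
    have := (hr (k + i)).le
    change M * _ * (_ * rhoWeight θ q₀ q₁ b b₀ b₁ (t (k + i))) ≤ _
    gcongr

theorem IsGeometricPartition.exists_tsum_KFun_le [IsTopologicalAddGroup V] [T2Space V]
    (hP : IsGeometricPartition q₀ q₁ b₀ b₁ Λ t)
    (h₀ : IsEmbeddedQuasiNorm 𝕜 N₀) (h₁ : IsEmbeddedQuasiNorm 𝕜 N₁)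
    (hq₀ : 0 < q₀) (hq₁ : 0 < q₁) (hq : 0 < q) (hb : IsSlowlyVarying b) (hb₀ : IsSV0 q₀ b₀)
    (hb₁ : IsSV0 q₁ b₁) (hθ₀ : 0 < θ) (hθ₁ : θ < 1) :
    ∃ C : ℝ≥0∞, C < ∞ ∧ ∀ f : V, (∀ k, KFun N₀ N₁ (t k) f < ∞) →
      ∑' k, (ENNReal.ofReal (rhoWeight θ q₀ q₁ b b₀ b₁ (t k)) *
        KFun (interpNorm N₀ N₁ 0 q₀ b₀) (interpNorm N₀ N₁ 0 q₁ b₁)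
          (rho q₀ q₁ b₀ b₁ (t k)) f) ^ q ≤
      C * ∑' k, (ENNReal.ofReal (rhoWeight θ q₀ q₁ b b₀ b₁ (t k)) *
        (ENNReal.ofReal (tailNorm q₀ b₀ (t k)) * KFun N₀ N₁ (t k) f)) ^ q := by
  obtain ⟨D, hD, hK⟩ := exists_KFun_rho_le (N₀ := N₀) (N₁ := N₁) h₀ h₁ hq₀ hq₁ hb₀ hb₁ hP
  obtain ⟨M, hM⟩ := hP.rhoWeight_le (θ := θ) hq₀ hq₁ hb hb₀ hb₁ hθ₀ hθ₁
  have hlt : ∀ α : ℝ, 0 < α → ENNReal.ofReal ((1 / 2) ^ α) < 1 := fun α hα =>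
    ENNReal.ofReal_lt_one.2 (Real.rpow_lt_one (by norm_num) (by norm_num) hα)
  obtain ⟨C₀, hC₀, hH₀⟩ := exists_tsum_weighted_le (hlt (θ / 2) (by positivity))
    (ENNReal.ofReal_lt_top (r := M)) hq₀ hq
  obtain ⟨C₁, hC₁, hH₁⟩ := exists_tsum_weighted_le (hlt ((1 - θ) / 2) (by linarith))
    (ENNReal.ofReal_lt_top (r := M)) hq₁ hq
  refine ⟨D ^ q * (2 ^ q * (C₀ + C₁)), ?_, fun f hf => ?_⟩
  · have := hq.le
    finiteness
  set w : ℤ → ℝ≥0∞ := fun k => ENNReal.ofReal (rhoWeight θ q₀ q₁ b b₀ b₁ (t k)) with hw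
  set r : ℤ → ℝ≥0∞ := fun k => ENNReal.ofReal (rho q₀ q₁ b₀ b₁ (t k)) with hr
  set a : ℤ → ℝ≥0∞ := fun k => ENNReal.ofReal (tailNorm q₀ b₀ (t k)) * KFun N₀ N₁ (t k) f with ha
  set a' : ℤ → ℝ≥0∞ := fun k =>
    ENNReal.ofReal (tailNorm q₁ b₁ (t k)) * KFun N₀ N₁ (t k) f with ha'
  have hra : ∀ k, r k * a' k = a k := fun k => by
    simp only [hr, ha, ha']
    rw [← mul_assoc, ← ENNReal.ofReal_mul (rho_pos hq₀ hq₁ hb₀ hb₁ (hP.pos k)).le,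
      rho_mul_tailNorm hq₁ hb₁ (hP.pos k)]
  -- The left sums use the weight `W` and exponent `q₀`, the right sums the weight `ρ W` and
  -- exponent `q₁`. Because `ρ N₁ = N₀`, both bounds end in the same sum.
  have h1 := hH₀ (fun i => Equiv.subRight (i : ℤ)) w a fun i k => (hM i k).1
  have h2 := hH₁ (fun i => Equiv.addRight (i : ℤ)) (fun k => r k * w k) a' fun i k => (hM i k).2
  simp only [Equiv.subRight_apply, Equiv.coe_addRight] at h1 h2
  have h3 : ∀ k, r k * w k * a' k = w k * a k := fun k => by
    rw [← hra]
    ring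
  simp only [h3] at h2
  set P : ℤ → ℝ≥0∞ := fun k => (∑' i : ℕ, a (k - i) ^ q₀) ^ (1 / q₀) with hPdef
  set Q : ℤ → ℝ≥0∞ := fun k => (∑' i : ℕ, a' (k + i) ^ q₁) ^ (1 / q₁) with hQdef
  calc _ ≤ ∑' k, D ^ q * (2 ^ q * ((w k * P k) ^ q + (r k * w k * Q k) ^ q)) := by
        refine ENNReal.tsum_le_tsum fun k => ?_
        calc _ ≤ (w k * (D * (P k + r k * Q k))) ^ q := by
              gcongr
              exact hK f hf k
          _ = D ^ q * (w k * P k + r k * w k * Q k) ^ q := by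
              rw [← ENNReal.mul_rpow_of_nonneg _ _ hq.le]
              congr 1
              ring
          _ ≤ _ := by
              gcongr
              exact add_rpow_le_two_rpow_mul hq.le _ _
    _ = D ^ q * (2 ^ q * (∑' k, (w k * P k) ^ q + ∑' k, (r k * w k * Q k) ^ q)) := by
        rw [ENNReal.tsum_mul_left, ENNReal.tsum_mul_left, ENNReal.tsum_add]
    _ ≤ D ^ q * (2 ^ q * (C₀ * ∑' k, (w k * a k) ^ q + C₁ * ∑' k, (w k * a k) ^ q)) := by
        gcongr
    _ = _ := by ring

/-- Two-sided comparison of the reiterated quasi-norm with the limiting one. -/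
theorem IsGeometricPartition.exists_interpNorm_le [IsTopologicalAddGroup V] [T2Space V]
    (hP : IsGeometricPartition q₀ q₁ b₀ b₁ Λ t)
    (hρ_mono : MonotoneOn (rho q₀ q₁ b₀ b₁) (Ioi 0))
    (h₀ : IsEmbeddedQuasiNorm 𝕜 N₀) (h₁ : IsEmbeddedQuasiNorm 𝕜 N₁)
    (hq₀ : 0 < q₀) (hq₁ : 0 < q₁) (hq : 0 < q) (hb : IsSlowlyVarying b) (hb₀ : IsSV0 q₀ b₀)
    (hb₁ : IsSV0 q₁ b₁) (hθ₀ : 0 < θ) (hθ₁ : θ < 1) :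
    ∃ C : ℝ≥0∞, C < ∞ ∧ ∀ f : V,
      (interpNorm (interpNorm N₀ N₁ 0 q₀ b₀) (interpNorm N₀ N₁ 0 q₁ b₁) θ q b f < ∞ →
        f ∈ sumSpace N₀ N₁ ∧
        interpNorm N₀ N₁ 0 q (btilde θ q q₀ q₁ b b₀ b₁) f ≤
          C * interpNorm (interpNorm N₀ N₁ 0 q₀ b₀) (interpNorm N₀ N₁ 0 q₁ b₁) θ q b f) ∧
      (interpNorm N₀ N₁ 0 q (btilde θ q q₀ q₁ b b₀ b₁) f < ∞ →
        f ∈ sumSpace (interpNorm N₀ N₁ 0 q₀ b₀) (interpNorm N₀ N₁ 0 q₁ b₁) ∧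
        interpNorm (interpNorm N₀ N₁ 0 q₀ b₀) (interpNorm N₀ N₁ 0 q₁ b₁) θ q b f ≤
          C * interpNorm N₀ N₁ 0 q (btilde θ q q₀ q₁ b b₀ b₁) f) := by
  obtain ⟨CA, hCA, hA⟩ := hP.exists_btilde_bounds (θ := θ) hρ_mono hq₀ hq₁ hq hb hb₀ hb₁ hθ₀ hθ₁
  obtain ⟨CX, hCX, hX⟩ := hP.exists_weight_bounds (θ := θ) hq₀ hq₁ hq hb hb₀ hb₁ hθ₀ hθ₁
  obtain ⟨CL, hL⟩ := exists_tailNorm_mul_KFun_le (N₀ := N₀) (N₁ := N₁) h₀ h₁ hq₀ hq₁ hb₀ hb₁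
  obtain ⟨CU, hCU, hU⟩ := hP.exists_tsum_KFun_le (N₀ := N₀) (N₁ := N₁) (q := q) (θ := θ) h₀ h₁
    hq₀ hq₁ hq hb hb₀ hb₁ hθ₀ hθ₁
  set X₀ : V → ℝ≥0∞ := interpNorm N₀ N₁ 0 q₀ b₀
  set X₁ : V → ℝ≥0∞ := interpNorm N₀ N₁ 0 q₁ b₁
  set W : ℤ → ℝ := fun k => rhoWeight θ q₀ q₁ b b₀ b₁ (t k) with hWdef
  set n : ℤ → ℝ := fun k => tailNorm q₀ b₀ (t k) with hndef
  set ρ : ℤ → ℝ := fun k => rho q₀ q₁ b₀ b₁ (t k) with hρdef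
  have hW : ∀ k, 0 < W k := fun k => rhoWeight_pos hq₀ hq₁ hb hb₀ hb₁ (hP.pos k)
  have hn : ∀ k, 0 < n k := fun k => tailNorm_pos hq₀ hb₀ (hP.pos k)
  have hρ : ∀ k, 0 < ρ k := fun k => rho_pos hq₀ hq₁ hb₀ hb₁ (hP.pos k)
  have hρmono : Monotone ρ := fun k l hkl => hρ_mono (hP.pos k) (hP.pos l) (hP.mono hkl)
  have hofW : ∀ k, ENNReal.ofReal (W k) ≠ 0 := fun k => (ENNReal.ofReal_pos.2 (hW k)).ne'
  have hofn : ∀ k, ENNReal.ofReal (n k) ≠ 0 := fun k => (ENNReal.ofReal_pos.2 (hn k)).ne'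
  have hterm : ∀ {u : ℤ → ℝ≥0∞}, ∑' k, u k ^ q < ∞ → ∀ k, u k < ∞ := fun h k => by
    have := (ENNReal.le_tsum k).trans_lt h
    rwa [ENNReal.rpow_lt_top_iff_of_pos hq] at this
  have hfac : ∀ {x y : ℝ≥0∞}, x ≠ 0 → x * y < ∞ → y < ∞ := fun {x y} hx h => by
    rcases ENNReal.mul_lt_top_iff.1 h with h | h | h
    · exact h.2
    · exact absurd h hx
    · exact h ▸ ENNReal.zero_lt_top
  have hAup : ∀ f : V, (∀ k, KFun N₀ N₁ (t k) f < ∞) →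
      interpNorm N₀ N₁ 0 q (btilde θ q q₀ q₁ b b₀ b₁) f ^ q ≤ ENNReal.ofReal CA *
        ∑' k, (ENNReal.ofReal (W k) * (ENNReal.ofReal (n k) * KFun N₀ N₁ (t k) f)) ^ q := by
    intro f hf
    rw [interpNorm_zero_rpow hq (fun _ => btilde_pos hq₀ hq₁ hb hb₀ hb₁)]
    simp only [← mul_assoc]
    refine lintegral_mul_rpow_le (A := fun k => ENNReal.ofReal (W k) * ENNReal.ofReal (n k)) hq
      hP.mono hP.cover (KFun_mono f) (fun k => (hf k).ne) fun k => ?_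
    refine (hA k).1.trans_eq ?_
    rw [ENNReal.ofReal_mul hCA.le, ← ENNReal.ofReal_mul (hW _).le, ENNReal.ofReal_rpow_of_nonneg
      (mul_pos (hW _) (hn _)).le hq.le]
  have hAlow : ∀ f : V,
      ∑' k, (ENNReal.ofReal (W k) * (ENNReal.ofReal (n k) * KFun N₀ N₁ (t k) f)) ^ q ≤
        ENNReal.ofReal CA * interpNorm N₀ N₁ 0 q (btilde θ q q₀ q₁ b b₀ b₁) f ^ q := by
    intro f
    rw [interpNorm_zero_rpow hq (fun _ => btilde_pos hq₀ hq₁ hb hb₀ hb₁)]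
    simp only [← mul_assoc]
    refine tsum_mul_rpow_le (A := fun k => ENNReal.ofReal (W k) * ENNReal.ofReal (n k)) hq
      hP.mono hP.cover (KFun_mono f) fun k => ?_
    refine le_of_eq_of_le ?_ (hA k).2
    rw [← ENNReal.ofReal_mul (hW _).le, ENNReal.ofReal_rpow_of_nonneg
      (mul_pos (hW _) (hn _)).le hq.le]
  have hXup : ∀ f : V, (∀ k, KFun X₀ X₁ (ρ k) f < ∞) →
      interpNorm X₀ X₁ θ q b f ^ q ≤
        ENNReal.ofReal CX * ∑' k, (ENNReal.ofReal (W k) * KFun X₀ X₁ (ρ k) f) ^ q := by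
    intro f hf
    rw [interpNorm_rpow hq hb.pos]
    refine lintegral_mul_rpow_le (t := ρ) (A := fun k => ENNReal.ofReal (W k)) hq hρmono
      hP.rho_cover (KFun_mono f) (fun k => (hf k).ne) fun k => ?_
    refine (hX k).1.trans_eq ?_
    rw [ENNReal.ofReal_mul hCX.le, ENNReal.ofReal_rpow_of_nonneg (hW _).le hq.le]
  have hXlow : ∀ f : V, ∑' k, (ENNReal.ofReal (W k) * KFun X₀ X₁ (ρ k) f) ^ q ≤
      ENNReal.ofReal CX * interpNorm X₀ X₁ θ q b f ^ q := by
    intro f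
    rw [interpNorm_rpow hq hb.pos]
    refine tsum_mul_rpow_le (t := ρ) (A := fun k => ENNReal.ofReal (W k)) hq hρmono
      hP.rho_cover (KFun_mono f) fun k => ?_
    refine le_of_eq_of_le ?_ (hX k).2
    rw [ENNReal.ofReal_rpow_of_nonneg (hW _).le hq.le]
  have hroot : ∀ {C x y : ℝ≥0∞}, x ^ q ≤ C * y ^ q → x ≤ C ^ (1 / q) * y := fun {C x y} h => by
    rw [← ENNReal.rpow_le_rpow_iff hq, ENNReal.mul_rpow_of_nonneg _ _ hq.le, ← ENNReal.rpow_mul,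
      one_div_mul_cancel hq.ne', ENNReal.rpow_one]
    exact h
  set C₁ : ℝ≥0∞ := ENNReal.ofReal CA * (CL ^ q * ENNReal.ofReal CX) with hC₁
  set C₂ : ℝ≥0∞ := ENNReal.ofReal CX * (CU * ENNReal.ofReal CA) with hC₂
  have hqn := hq.le
  have hqn' : 0 ≤ 1 / q := by positivity
  have hC₁t : C₁ ≠ ∞ := by finiteness
  have hC₂t : C₂ ≠ ∞ := by finiteness
  refine ⟨C₁ ^ (1 / q) + C₂ ^ (1 / q), by finiteness, fun f => ⟨fun hf => ?_, fun hf => ?_⟩⟩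
  -- A finite sum with positive weights makes every K-functional value finite. This gives membership
  -- in the sum space and the finiteness that the upper discretization requires.
  · have hsum : ∑' k, (ENNReal.ofReal (W k) * KFun X₀ X₁ (ρ k) f) ^ q < ∞ :=
      (hXlow f).trans_lt (by finiteness)
    have hKbar : ∀ k, KFun X₀ X₁ (ρ k) f < ∞ := fun k => hfac (hofW k) (hterm hsum k)
    have hK : ∀ k, KFun N₀ N₁ (t k) f < ∞ := fun k =>
      hfac (hofn k) ((hL (t k) (hP.pos k) f).trans_lt (ENNReal.mul_lt_top ENNReal.coe_lt_top
        (hKbar k)))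
    refine ⟨mem_sumSpace_of_KFun_lt_top (hP.pos 0) (hK 0), (hroot (C := C₁) ?_).trans
      (by gcongr; exact le_self_add)⟩
    calc _ ≤ ENNReal.ofReal CA *
          ∑' k, (ENNReal.ofReal (W k) * (ENNReal.ofReal (n k) * KFun N₀ N₁ (t k) f)) ^ q :=
          hAup f hK
      _ ≤ ENNReal.ofReal CA * ∑' k, CL ^ q * (ENNReal.ofReal (W k) * KFun X₀ X₁ (ρ k) f) ^ q := by
          gcongr with k
          rw [← ENNReal.mul_rpow_of_nonneg _ _ hq.le, mul_left_comm (CL : ℝ≥0∞)]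
          exact ENNReal.rpow_le_rpow (mul_le_mul_right (hL (t k) (hP.pos k) f) _) hq.le
      _ ≤ ENNReal.ofReal CA * (CL ^ q *
            (ENNReal.ofReal CX * interpNorm X₀ X₁ θ q b f ^ q)) := by
          rw [ENNReal.tsum_mul_left]
          gcongr
          exact hXlow f
      _ = _ := by
          rw [hC₁]
          ring
  · have hsum : ∑' k, (ENNReal.ofReal (W k) *
        (ENNReal.ofReal (n k) * KFun N₀ N₁ (t k) f)) ^ q < ∞ :=
      (hAlow f).trans_lt (by finiteness)
    have hK : ∀ k, KFun N₀ N₁ (t k) f < ∞ := fun k =>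
      hfac (hofn k) (hfac (hofW k) (hterm hsum k))
    have hU' := hU f hK
    have hKbar : ∀ k, KFun X₀ X₁ (ρ k) f < ∞ := fun k =>
      hfac (hofW k) (hterm (hU'.trans_lt (ENNReal.mul_lt_top hCU hsum)) k)
    refine ⟨mem_sumSpace_of_KFun_lt_top (hρ 0) (hKbar 0), (hroot (C := C₂) ?_).trans
      (by gcongr; exact le_add_self)⟩
    calc _ ≤ ENNReal.ofReal CX * ∑' k, (ENNReal.ofReal (W k) * KFun X₀ X₁ (ρ k) f) ^ q :=
          hXup f hKbar
      _ ≤ ENNReal.ofReal CX * (CU * (ENNReal.ofReal CA *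
            interpNorm N₀ N₁ 0 q (btilde θ q q₀ q₁ b b₀ b₁) f ^ q)) := by
          gcongr
          exact hU'.trans (by gcongr; exact hAlow f)
      _ = _ := by
          rw [hC₂]
          ring

end Reiteration

end LimitingReiteration

theorem mainTheorem7 {𝕜 : Type*} [RCLike 𝕜] {V : Type*} [AddCommGroup V] [Module 𝕜 V]
    [TopologicalSpace V] [IsTopologicalAddGroup V] [ContinuousSMul 𝕜 V] [T2Space V]
    (A₀ A₁ : V → ℝ≥0∞)
    (hA₀ : LimitingReiteration.IsEmbeddedQuasiNorm 𝕜 A₀)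
    (hA₁ : LimitingReiteration.IsEmbeddedQuasiNorm 𝕜 A₁)
    (q₀ q₁ q θ : ℝ) (hq₀ : 0 < q₀) (hq₁ : 0 < q₁) (hq : 0 < q) (hθ₀ : 0 < θ) (hθ₁ : θ < 1)
    (b₀ b₁ b : ℝ → ℝ)
    (hb₀ : LimitingReiteration.IsSV0 q₀ b₀) (hb₁ : LimitingReiteration.IsSV0 q₁ b₁)
    (hb : LimitingReiteration.IsSlowlyVarying b)
    (hρ_mono : MonotoneOn (LimitingReiteration.rho q₀ q₁ b₀ b₁) (Ioi 0))
    (hρ_zero : Tendsto (LimitingReiteration.rho q₀ q₁ b₀ b₁) (𝓝[>] 0) (𝓝 0))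
    (hρ_top : Tendsto (LimitingReiteration.rho q₀ q₁ b₀ b₁) atTop atTop)
    (h_ne : q₀ ≠ q₁ → ∃ ε : ℝ, 0 < ε ∧
      LimitingReiteration.EquivNondecreasing (LimitingReiteration.rhoEps ε q₀ q₁ b₀ b₁))
    (h_eq : q₀ = q₁ → LimitingReiteration.KSurjective A₀ A₁ ∧
      ∃ c C : ℝ, 0 < c ∧ 0 < C ∧ ∀ᵐ t ∂(volume.restrict (Ioi (0 : ℝ))),
        c * (t⁻¹ * b₁ t ^ q₁ / LimitingReiteration.tail q₁ b₁ t) ≤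
            deriv (LimitingReiteration.rho q₀ q₁ b₀ b₁) t / LimitingReiteration.rho q₀ q₁ b₀ b₁ t ∧
          deriv (LimitingReiteration.rho q₀ q₁ b₀ b₁) t / LimitingReiteration.rho q₀ q₁ b₀ b₁ t ≤
            C * (t⁻¹ * b₁ t ^ q₁ / LimitingReiteration.tail q₁ b₁ t)) :
    LimitingReiteration.interpSpace
        (LimitingReiteration.interpNorm A₀ A₁ 0 q₀ b₀)
        (LimitingReiteration.interpNorm A₀ A₁ 0 q₁ b₁) θ q b =
      LimitingReiteration.interpSpace A₀ A₁ 0 q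
        (LimitingReiteration.btilde θ q q₀ q₁ b b₀ b₁) ∧
    ∃ c C : ℝ, 0 < c ∧ 0 < C ∧
      ∀ f ∈ LimitingReiteration.interpSpace A₀ A₁ 0 q
          (LimitingReiteration.btilde θ q q₀ q₁ b b₀ b₁),
        ENNReal.ofReal c * LimitingReiteration.interpNorm A₀ A₁ 0 q
            (LimitingReiteration.btilde θ q q₀ q₁ b b₀ b₁) f ≤
          LimitingReiteration.interpNorm
            (LimitingReiteration.interpNorm A₀ A₁ 0 q₀ b₀)
            (LimitingReiteration.interpNorm A₀ A₁ 0 q₁ b₁) θ q b f ∧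
        LimitingReiteration.interpNorm
            (LimitingReiteration.interpNorm A₀ A₁ 0 q₀ b₀)
            (LimitingReiteration.interpNorm A₀ A₁ 0 q₁ b₁) θ q b f ≤
          ENNReal.ofReal C * LimitingReiteration.interpNorm A₀ A₁ 0 q
            (LimitingReiteration.btilde θ q q₀ q₁ b b₀ b₁) f := by
  obtain ⟨ε, M, hε, hM, hqm⟩ := LimitingReiteration.exists_rhoEps_le hq₀ hq₁ hb₀ hb₁ h_ne
    fun h => by
      obtain ⟨-, c, _, hc, -, hae⟩ := h_eq h
      exact ⟨c, hc, hae.mono fun _ ht => ht.1⟩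
  obtain ⟨Λ, t, hP⟩ := LimitingReiteration.exists_isGeometricPartition hq₀ hq₁ hb₀ hb₁ hρ_mono
    hρ_zero hρ_top hε hM hqm
  obtain ⟨C, hC, h⟩ := hP.exists_interpNorm_le (N₀ := A₀) (N₁ := A₁) (q := q) (θ := θ) (b := b)
    hρ_mono hA₀ hA₁ hq₀ hq₁ hq hb hb₀ hb₁ hθ₀ hθ₁
  -- Adding 1 makes the constant positive even when `C = 0`, so it can also be inverted.
  refine ⟨Set.ext fun f => ⟨fun hf => ?_, fun hf => ?_⟩, (C.toReal + 1)⁻¹, C.toReal + 1,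
    by positivity, by positivity, fun f hf => ?_⟩
  · obtain ⟨h1, h2⟩ := (h f).1 hf.2
    exact ⟨h1, h2.trans_lt (ENNReal.mul_lt_top hC hf.2)⟩
  · obtain ⟨h1, h2⟩ := (h f).2 hf.2
    exact ⟨h1, h2.trans_lt (ENNReal.mul_lt_top hC hf.2)⟩
  have hle : C ≤ ENNReal.ofReal (C.toReal + 1) := by
    conv_lhs => rw [← ENNReal.ofReal_toReal hC.ne]
    exact ENNReal.ofReal_le_ofReal (by linarith)
  have hX := ((h f).2 hf.2).2
  have hA := ((h f).1 (hX.trans_lt (ENNReal.mul_lt_top hC hf.2))).2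
  refine ⟨?_, hX.trans (by gcongr)⟩
  rw [ENNReal.ofReal_inv_of_pos (by positivity), mul_comm, ← div_eq_mul_inv]
  exact ENNReal.div_le_of_le_mul' (hA.trans (by gcongr))
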